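/- Let $\mathbb{Z}_2=\{1,-1\}$ and let $H^n_{\mathbb{Z}_2}(X)=H^n(E\mathbb{Z}_2\times_{\mathbb{Z}_2}X;\mathbb{Z})$ denote Borel equivariant cohomology. A $\mathbb{Z}_2$-equivariant circle bundle over a $\mathbb{Z}_2$-space $X$ is a principal $\mathrm{U}(1)$-bundle $\pi:E\to X$ together with an involution of $E$ that lifts the involution of $X$ and commutes with the $\mathrm{U}(1)$-action; $c_1^{\mathbb{Z}_2}(E)\in H^2_{\mathbb{Z}_2}(X)$ is its equivariant first Chern class and $\pi_*:H^{n+1}_{\mathbb{Z}_2}(E)\to H^{n}_{\mathbb{Z}_2}(X)$ is integration along the fibre. A ($\mathbb{Z}_2$-equivariant) pair $(E,h)$ on $X$ is such a bundle with a class $h\in H^3_{\mathbb{Z}_2}(E)$; an isomorphism $(E,h)\cong(E',h')$ is an isomorphism $\varphi:E\to E'$ of $\mathbb{Z}_2$-equivariant circle bundles over $X$ with $\varphi^*h'=h$. Two pairs $(E,h)$ and $(\hat E,\hat h)$ on $X$, with bundle projections $\pi,\hat\pi$ and with $p,\hat p$ the projections of $E\times_X\hat E$ onto $E,\hat E$,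 are $\mathbb{Z}_2$-equivariantly T-dual if $$c_1^{\mathbb{Z}_2}(\hat E)=\pi_*h,\qquad c_1^{\mathbb{Z}_2}(E)=\hat\pi_*\hat h,\qquad p^*h=\hat p^*\hat h .$$ Over a point, let $S^1_{\rm triv}$ and $S^1_{\rm free}$ be the circle $\mathrm{U}(1)$ with the involutions $u\mapsto u$ and $u\mapsto -u$ respectively. Let $\tau_{S^1}\in H^3_{\mathbb{Z}_2}(S^1_{\rm triv})$ be the class (under the Bockstein map of $0\to\mathbb{Z}\to\mathbb{R}\to\mathrm{U}(1)\to0$) of the group $2$-cocycle of $\mathbb{Z}_2$ with values in $C(S^1_{\rm triv},\mathrm{U}(1))$ whose value at $(-1,-1)$ is the function $u\mapsto u$ and whose other values are $1$. **Proposition.** The class $\tau_{S^1}$ is well defined, and, up to isomorphism, the $\mathbb{Z}_2$-equivariant T-dual pairs over a point are exactly $$(S^1_{\rm free},0)\leftrightarrow(S^1_{\rm triv},\tau_{S^1})\qquad\text{and}\qquad(S^1_{\rm triv},0)\leftrightarrow(S^1_{\rm triv},0).$$ That is, two pairs $(E,h)$ and $(\hat E,\hat h)$ over a point are T-dual if and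 only if, up to exchanging the two, $(E,h)\cong(S^1_{\rm free},0)$ and $(\hat E,\hat h)\cong(S^1_{\rm triv},\tau_{S^1})$, or $(E,h)\cong(S^1_{\rm triv},0)$ and $(\hat E,\hat h)\cong(S^1_{\rm triv},0)$. -/

import Mathlib

open scoped BigOperators

noncomputable section

namespace EquivTDuality

/-! ### Singular cohomology with integer coefficients -/

/-- Singular `n`-simplices of `X`: continuous maps from the standard `n`-simplex. -/
abbrev Sing (n : ℕ) (X : Type) [TopologicalSpace X] : Type :=
  C(stdSimplex ℝ (Fin (n + 1)), X)

/-- The affine map between standard simplices given by a map of vertices. -/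
def simplexMap {m n : ℕ} (f : Fin (m + 1) → Fin (n + 1)) :
    C(stdSimplex ℝ (Fin (m + 1)), stdSimplex ℝ (Fin (n + 1))) :=
  ⟨stdSimplex.map f, stdSimplex.continuous_map f⟩

/-- Integral singular `n`-cochains. -/
abbrev Cochain (n : ℕ) (X : Type) [TopologicalSpace X] : Type := Sing n X → ℤ

section Cohomology

variable {X Y : Type} [TopologicalSpace X] [TopologicalSpace Y]

/-- The singular coboundary `(d a)(σ) = ∑ i, (-1) ^ i * a (i-th face of σ)`. -/
def cobd (n : ℕ) : Cochain n X →+ Cochain (n + 1) X where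
  toFun a := fun σ => ∑ i : Fin (n + 2), (-1) ^ (i : ℕ) * a (σ.comp (simplexMap i.succAbove))
  map_zero' := by
    funext σ
    simp
  map_add' a b := by
    funext σ
    simp [mul_add, Finset.sum_add_distrib]

/-- Pull-back of cochains along a continuous map. -/
def pull (n : ℕ) (f : C(X, Y)) : Cochain n Y →+ Cochain n X where
  toFun a := fun σ => a (f.comp σ)
  map_zero' := rfl
  map_add' _ _ := rfl

theorem cobd_pull (n : ℕ) (f : C(X, Y)) (a : Cochain n Y) :
    cobd n (pull n f a) = pull (n + 1) f (cobd n a) := rfl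

/-- The cup product of cochains: front `p`-face times back `q`-face. -/
def cup {p q : ℕ} (a : Cochain p X) (b : Cochain q X) : Cochain (p + q) X := fun σ =>
  a (σ.comp (simplexMap (m := p) (n := p + q) fun i => ⟨i.val, by omega⟩)) *
    b (σ.comp (simplexMap (m := q) (n := p + q) fun j => ⟨p + j.val, by omega⟩))

end Cohomology

section CohomologyGroups

variable (n : ℕ) (X : Type) [TopologicalSpace X]

/-- Singular cocycles. -/
def cocycles : AddSubgroup (Cochain n X) := (cobd n).ker

/-- Singular coboundaries. -/
def coboundaries : (n : ℕ) → AddSubgroup (Cochain n X)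
  | 0 => ⊥
  | k + 1 => (cobd k).range

/-- Singular cohomology `Hⁿ(X; ℤ)`. -/
abbrev Coh : Type := cocycles n X ⧸ (coboundaries X n).addSubgroupOf (cocycles n X)

variable {n X}

/-- The cohomology class of a cocycle. -/
def cls (z : cocycles n X) : Coh n X := QuotientAddGroup.mk z

variable {Y : Type} [TopologicalSpace Y]

/-- Pull-back of cocycles. -/
def pullCocycles (n : ℕ) (f : C(X, Y)) : cocycles n Y →+ cocycles n X :=
  ((pull n f).comp (cocycles n Y).subtype).codRestrict (cocycles n X) (fun z => by
    have hz : cobd n (z : Cochain n Y) = 0 := z.2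
    change cobd n (pull n f (z : Cochain n Y)) = 0
    rw [cobd_pull, hz, map_zero])

/-- Pull-back in cohomology. -/
def pullCoh (n : ℕ) (f : C(X, Y)) : Coh n Y →+ Coh n X :=
  QuotientAddGroup.map _ _ (pullCocycles n f) (by
    intro z hz
    change ((pullCocycles n f z : cocycles n X) : Cochain n X) ∈ coboundaries X n
    have hz' : (z : Cochain n Y) ∈ coboundaries Y n := hz
    cases n with
    | zero =>
      have h0 : (z : Cochain 0 Y) = 0 := hz'
      change pull 0 f (z : Cochain 0 Y) = 0
      rw [h0, map_zero]
    | succ k =>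
      obtain ⟨a, ha⟩ := hz'
      refine ⟨pull k f a, ?_⟩
      rw [cobd_pull, ha]
      rfl)

end CohomologyGroups

/-! ### `ℤ₂`-spaces and the Borel construction

`ℤ₂ = {1, -1}` is `ℤˣ`; a `ℤ₂`-space is a topological space with a continuous action of `ℤˣ`. -/

/-- The action of `{1, -1}` in which `-1` acts by a given involution. -/
abbrev involutionAction {X : Type} (f : X → X) (hf : Function.Involutive f) :
    MulAction ℤˣ X where
  smul g x := if g = 1 then x else f x
  one_smul x := if_pos rfl
  mul_smul g h x := by
    change (if g * h = 1 then x else f x) =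
      if g = 1 then (if h = 1 then x else f x) else f (if h = 1 then x else f x)
    rcases Int.units_eq_one_or g with rfl | rfl <;>
      rcases Int.units_eq_one_or h with rfl | rfl <;> simp [hf x]

theorem continuousConstSMul_involutionAction {X : Type} [TopologicalSpace X] (f : X → X)
    (hf : Function.Involutive f) (hc : Continuous f) :
    @ContinuousConstSMul ℤˣ X _ (involutionAction f hf).toSMul := by
  let := involutionAction f hf
  refine ⟨fun g => ?_⟩
  change Continuous fun x => if g = 1 then x else f x
  by_cases h : g = 1
  · simp only [h, if_true]
    exact continuous_id
  · simp only [h, if_false]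
    exact hc

/-- The total space `Eℤ₂` of the universal `ℤ₂`-bundle: the unit sphere `S^∞` of the real Hilbert
space `ℓ²`, a contractible space on which `ℤ₂` acts freely by the antipodal map. -/
def EZ2 : Type := Metric.sphere (0 : lp (fun _ : ℕ => ℝ) 2) 1

instance : TopologicalSpace EZ2 :=
  inferInstanceAs (TopologicalSpace (Metric.sphere (0 : lp (fun _ : ℕ => ℝ) 2) 1))

/-- The antipodal map of `S^∞`. -/
def antipode : EZ2 → EZ2 :=
  fun s => (-(show Metric.sphere (0 : lp (fun _ : ℕ => ℝ) 2) 1 from s) :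
    Metric.sphere (0 : lp (fun _ : ℕ => ℝ) 2) 1)

theorem antipode_involutive : Function.Involutive antipode := fun s =>
  neg_neg (show Metric.sphere (0 : lp (fun _ : ℕ => ℝ) 2) 1 from s)

theorem antipode_continuous : Continuous antipode :=
  (continuous_neg : Continuous fun s : Metric.sphere (0 : lp (fun _ : ℕ => ℝ) 2) 1 => -s)

instance : MulAction ℤˣ EZ2 := involutionAction antipode antipode_involutive

instance : ContinuousConstSMul ℤˣ EZ2 :=
  continuousConstSMul_involutionAction antipode antipode_involutive antipode_continuous

section BorelConstruction

variable (X : Type) [TopologicalSpace X] [MulAction ℤˣ X]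

/-- The Borel construction `Eℤ₂ ×_{ℤ₂} X`, the quotient of `Eℤ₂ × X` by the diagonal action. -/
def Borel : Type := MulAction.orbitRel.Quotient ℤˣ (EZ2 × X)

instance : TopologicalSpace (Borel X) :=
  inferInstanceAs (TopologicalSpace (Quotient (MulAction.orbitRel ℤˣ (EZ2 × X))))

/-- The quotient map `Eℤ₂ × X → Eℤ₂ ×_{ℤ₂} X`. -/
def borelMk : C(EZ2 × X, Borel X) :=
  ⟨Quotient.mk (MulAction.orbitRel ℤˣ (EZ2 × X)), continuous_quotient_mk'⟩

/-- Borel equivariant cohomology `Hⁿ_{ℤ₂}(X; ℤ)`. -/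
abbrev EqCoh (n : ℕ) : Type := Coh n (Borel X)

variable {X} {Y : Type} [TopologicalSpace Y] [MulAction ℤˣ Y]

/-- The map of Borel constructions induced by an equivariant map. -/
def borelMap (f : C(X, Y)) (hf : ∀ (g : ℤˣ) (x : X), f (g • x) = g • f x) :
    C(Borel X, Borel Y) where
  toFun := Quotient.map (fun p : EZ2 × X => (p.1, f p.2)) (by
    rintro p q ⟨g, rfl⟩
    exact ⟨g, Prod.ext rfl (hf g q.2).symm⟩)
  continuous_toFun := by
    refine Continuous.quotient_map' ?_ _
    fun_prop

end BorelConstruction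

/-! ### `ℤ₂`-equivariant principal circle bundles -/

/-- A `ℤ₂`-equivariant principal circle bundle over the `ℤ₂`-space `X`: a locally trivial principal
`U(1)`-bundle with an involution of the total space that lifts the involution of `X` and commutes
with the `U(1)`-action. -/
structure CircleBundle (X : Type) [TopologicalSpace X] [MulAction ℤˣ X] where
  Total : Type
  [topology : TopologicalSpace Total]
  [z2Action : MulAction ℤˣ Total]
  [z2Continuous : ContinuousConstSMul ℤˣ Total]
  [circleAction : MulAction Circle Total]
  [circleContinuous : ContinuousSMul Circle Total]
  [actionsCommute : SMulCommClass ℤˣ Circle Total]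
  proj : C(Total, X)
  proj_z2 : ∀ (g : ℤˣ) (ξ : Total), proj (g • ξ) = g • proj ξ
  proj_circle : ∀ (u : Circle) (ξ : Total), proj (u • ξ) = proj ξ
  locallyTrivial : ∀ x : X, ∃ e : Bundle.Trivialization Circle proj, x ∈ e.baseSet ∧
    ∀ (u : Circle) (ξ : Total), proj ξ ∈ e.baseSet → (e (u • ξ)).2 = u * (e ξ).2

attribute [instance] CircleBundle.topology CircleBundle.z2Action CircleBundle.z2Continuous
  CircleBundle.circleAction CircleBundle.circleContinuous CircleBundle.actionsCommute

/-- The loop `Δ¹ → U(1)`, `(1 - s, s) ↦ exp (2 π i s)`. -/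
def standardLoop : Sing 1 Circle :=
  ⟨fun p => Circle.exp (2 * Real.pi * p 1), by
    refine Circle.exp.continuous.comp (continuous_const.mul ?_)
    exact (continuous_apply (1 : Fin 2)).comp continuous_subtype_val⟩

namespace CircleBundle

variable {X : Type} [TopologicalSpace X] [MulAction ℤˣ X] (E : CircleBundle X)

/-- The principal circle bundle `Eℤ₂ ×_{ℤ₂} E → Eℤ₂ ×_{ℤ₂} X`. -/
def borelProj : C(Borel E.Total, Borel X) := borelMap E.proj E.proj_z2

/-- The parametrization `u ↦ [s, ξ u]` of the fibre of `Eℤ₂ ×_{ℤ₂} E → Eℤ₂ ×_{ℤ₂} X` through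
`[s, ξ]`. -/
def fibre (s : EZ2) (ξ : E.Total) : C(Circle, Borel E.Total) :=
  (borelMk E.Total).comp ⟨fun u => (s, u • ξ), by fun_prop⟩

/-- `α` is a global angular cochain on `Eℤ₂ ×_{ℤ₂} E` with `d α = - π^* β`: it restricts to a
cocycle on each fibre, whose class is the positive generator of `H¹(S¹; ℤ)`. Equivalently, `(β, -α)`
is a cocycle of the mapping cone of `π^*` (the relative cochains of disk bundle and circle bundle)
that represents the Thom class; `β` represents its restriction to the zero section. -/
structure IsAngular (α : Cochain 1 (Borel E.Total)) (β : cocycles 2 (Borel X)) : Prop where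
  cobd_eq : cobd 1 α = -pull 2 E.borelProj β
  fibre_closed : ∀ (s : EZ2) (ξ : E.Total), cobd 1 (pull 1 (E.fibre s ξ) α) = 0
  fibre_loop : ∀ (s : EZ2) (ξ : E.Total), pull 1 (E.fibre s ξ) α standardLoop = 1

/-- `c` is the equivariant first Chern (Euler) class `c₁^{ℤ₂}(E) ∈ H²_{ℤ₂}(X; ℤ)`, the restriction
of the Thom class to the zero section. -/
def IsChernClass (c : EqCoh X 2) : Prop :=
  ∃ (α : Cochain 1 (Borel E.Total)) (β : cocycles 2 (Borel X)), E.IsAngular α β ∧ cls β = c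

/-- `x = π_* h` for the push-forward (integration along the fibre)
`π_* : Hⁿ⁺¹_{ℤ₂}(E) → Hⁿ_{ℤ₂}(X)` of the Gysin sequence: `h` is represented by a cocycle
`π^* y + π^* w ∪ α` with `w` a cocycle representing `x` and `α` a global angular cochain.
(Equivalently, the connecting homomorphism of disk bundle and circle bundle maps `h` to the product
of `x` and the Thom class, up to the conventional sign.) -/
def IsPushforward {n : ℕ} (h : EqCoh E.Total (n + 1)) (x : EqCoh X n) : Prop :=
  ∃ (α : Cochain 1 (Borel E.Total)) (β : cocycles 2 (Borel X)) (y : Cochain (n + 1) (Borel X))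
    (w : cocycles n (Borel X)) (z : cocycles (n + 1) (Borel E.Total)),
    E.IsAngular α β ∧ cls w = x ∧ cls z = h ∧
      (z : Cochain (n + 1) (Borel E.Total)) =
        pull (n + 1) E.borelProj y + cup (pull n E.borelProj w) α

/-- Isomorphisms of `ℤ₂`-equivariant circle bundles over `X`. -/
structure Iso (E F : CircleBundle X) where
  toHomeomorph : E.Total ≃ₜ F.Total
  map_proj : ∀ ξ, F.proj (toHomeomorph ξ) = E.proj ξ
  map_z2 : ∀ (g : ℤˣ) ξ, toHomeomorph (g • ξ) = g • toHomeomorph ξ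
  map_circle : ∀ (u : Circle) ξ, toHomeomorph (u • ξ) = u • toHomeomorph ξ

/-- The fibre product `E ×_X F`. -/
def FibreProduct (E F : CircleBundle X) : Type :=
  {p : E.Total × F.Total // E.proj p.1 = F.proj p.2}

instance (E F : CircleBundle X) : TopologicalSpace (FibreProduct E F) :=
  inferInstanceAs (TopologicalSpace {p : E.Total × F.Total // E.proj p.1 = F.proj p.2})

instance (E F : CircleBundle X) : MulAction ℤˣ (FibreProduct E F) where
  smul g p := ⟨(g • p.1.1, g • p.1.2), by rw [E.proj_z2, F.proj_z2, p.2]⟩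
  one_smul p := Subtype.ext (Prod.ext (one_smul ℤˣ p.1.1) (one_smul ℤˣ p.1.2))
  mul_smul g h p := Subtype.ext (Prod.ext (mul_smul g h p.1.1) (mul_smul g h p.1.2))

/-- The projection `p : E ×_X F → E`, on Borel constructions. -/
def borelFst (E F : CircleBundle X) : C(Borel (FibreProduct E F), Borel E.Total) :=
  borelMap ⟨fun p => p.1.1, continuous_fst.comp continuous_subtype_val⟩ (fun _ _ => rfl)

/-- The projection `p̂ : E ×_X F → F`, on Borel constructions. -/
def borelSnd (E F : CircleBundle X) : C(Borel (FibreProduct E F), Borel F.Total) :=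
  borelMap ⟨fun p => p.1.2, continuous_snd.comp continuous_subtype_val⟩ (fun _ _ => rfl)

end CircleBundle

/-! ### Pairs and T-duality -/

/-- A `ℤ₂`-equivariant pair `(E, h)` on `X`: a circle bundle `E` and a class
`h ∈ H³_{ℤ₂}(E; ℤ)`. -/
structure Pair (X : Type) [TopologicalSpace X] [MulAction ℤˣ X] where
  bundle : CircleBundle X
  twist : EqCoh bundle.Total 3

namespace Pair

variable {X : Type} [TopologicalSpace X] [MulAction ℤˣ X]

/-- `(E, h)` and `(F, k)` are isomorphic: there is a bundle isomorphism `φ : E → F` with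
`φ^* k = h`. -/
def IsIsomorphic (P Q : Pair X) : Prop :=
  ∃ φ : CircleBundle.Iso P.bundle Q.bundle,
    pullCoh 3 (borelMap (φ.toHomeomorph : C(P.bundle.Total, Q.bundle.Total)) φ.map_z2) Q.twist =
      P.twist

/-- `ℤ₂`-equivariant T-duality of `(E, h)` and `(Ê, ĥ)`: `c₁(Ê) = π_* h`, `c₁(E) = π̂_* ĥ` and
`p^* h = p̂^* ĥ` on `E ×_X Ê`. -/
def IsTDual (P Q : Pair X) : Prop :=
  (∃ c : EqCoh X 2, Q.bundle.IsChernClass c ∧ P.bundle.IsPushforward P.twist c) ∧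
  (∃ c : EqCoh X 2, P.bundle.IsChernClass c ∧ Q.bundle.IsPushforward Q.twist c) ∧
  pullCoh 3 (CircleBundle.borelFst P.bundle Q.bundle) P.twist =
    pullCoh 3 (CircleBundle.borelSnd P.bundle Q.bundle) Q.twist

end Pair

/-! ### Twists from group 2-cocycles -/

/-- A group 2-cocycle of `ℤ₂` with values in the module `C(X, U(1))`, on which `g` acts by
`(g · f)(x) = f (g⁻¹ x)`. -/
structure TwoCocycle (X : Type) [TopologicalSpace X] [MulAction ℤˣ X] where
  toFun : ℤˣ → ℤˣ → C(X, Circle)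
  cocycle : ∀ (g h k : ℤˣ) (x : X),
    toFun h k (g⁻¹ • x) * toFun g (h * k) x = toFun (g * h) k x * toFun g h x

section CocycleClass

variable {X : Type} [TopologicalSpace X] [MulAction ℤˣ X] [ContinuousConstSMul ℤˣ X]

/-- Translation of singular cochains by a group element, `(g · a)(σ) = a (g⁻¹ ∘ σ)`. -/
def translate {n : ℕ} (g : ℤˣ) (a : Cochain n X) : Cochain n X :=
  pull n (⟨fun x => g⁻¹ • x, continuous_const_smul _⟩ : C(X, X)) a

/-- `h ∈ H³_{ℤ₂}(X; ℤ)` is the class of the group 2-cocycle `c` with values in `C(X, U(1))`, i.e.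
its image under the Bockstein map of `0 → ℤ → ℝ → U(1) → 0`.

This is written out in the double complex `K^{p,q}` of group `p`-cochains of `ℤ₂` with values in the
singular `q`-cochains of `Y = Eℤ₂ × X`, whose total complex (differential `δ + (-1)^p d`) computes
`H^*_{ℤ₂}(X; ℤ)` through the pull-back of cochains from `Eℤ₂ ×_{ℤ₂} X` to `K^{0,*}`. Choose (not
necessarily continuous) logarithms `l g k : Y → ℝ` of `c g k` with `δ l = 0`. For a singular
`1`-simplex `σ` of `Y` the difference of `l g k (σ 1) - l g k (σ 0)` and of the increment along `σ` of
a continuous logarithm of `c g k` is an integer, and these integers form the cocycle in `K^{2,1}`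
that represents the class of `c`. It is cohomologous to the pull-back of a cocycle `z` representing
`h`, through cochains `a ∈ K^{0,2}` and `b ∈ K^{1,1}`. -/
def TwoCocycle.Represents (c : TwoCocycle X) (h : EqCoh X 3) : Prop :=
  ∃ (l : ℤˣ → ℤˣ → EZ2 × X → ℝ) (b : ℤˣ → Cochain 1 (EZ2 × X)) (a : Cochain 2 (EZ2 × X))
    (z : cocycles 3 (Borel X)),
    (∀ g k y, Circle.exp (2 * Real.pi * l g k y) = c.toFun g k y.2) ∧
    (∀ g h k y, l h k (g⁻¹ • y) - l (g * h) k y + l g (h * k) y - l g h y = 0) ∧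
    (∀ (g k : ℤˣ) (σ : Sing 1 (EZ2 × X)) (r : C(stdSimplex ℝ (Fin 2), ℝ)),
      (∀ p, Circle.exp (2 * Real.pi * r p) = c.toFun g k (σ p).2) →
      (r (stdSimplex.vertex 1) - r (stdSimplex.vertex 0)) -
          (l g k (σ (stdSimplex.vertex 1)) - l g k (σ (stdSimplex.vertex 0))) =
        (((translate g (b k) - b (g * k) + b g) σ : ℤ) : ℝ)) ∧
    (∀ g, translate g a - a = cobd 1 (b g)) ∧
    pull 3 (borelMk X) z = cobd 2 a ∧
    cls z = h

end CocycleClass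

/-! ### The involutive circles over a point -/

/-- The projection of the circle to a point is trivial. -/
theorem circle_locallyTrivial (x : Unit) :
    ∃ e : Bundle.Trivialization Circle (ContinuousMap.const Circle () : Circle → Unit),
      x ∈ e.baseSet ∧ ∀ (u ξ : Circle),
        (ContinuousMap.const Circle () : Circle → Unit) ξ ∈ e.baseSet →
          (e (u * ξ)).2 = u * (e ξ).2 := by
  let e : Bundle.Trivialization Circle (ContinuousMap.const Circle () : Circle → Unit) :=
    { toOpenPartialHomeomorph := (Homeomorph.punitProd Circle).symm.toOpenPartialHomeomorph
      baseSet := Set.univ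
      open_baseSet := isOpen_univ
      source_eq := rfl
      target_eq := by simp
      proj_toFun := fun _ _ => rfl }
  exact ⟨e, Set.mem_univ _, fun _ _ _ => rfl⟩

/-- `S¹_triv → pt`: the circle with the trivial involution. -/
def circleTriv : CircleBundle Unit where
  Total := Circle
  topology := inferInstance
  z2Action := involutionAction id (fun _ => rfl)
  z2Continuous := continuousConstSMul_involutionAction id (fun _ => rfl) continuous_id
  circleAction := Monoid.toMulAction Circle
  circleContinuous := inferInstance
  actionsCommute := by
    let := involutionAction (X := Circle) id (fun _ => rfl)
    refine ⟨fun g u ξ => ?_⟩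
    change (if g = 1 then u * ξ else u * ξ) = u * (if g = 1 then ξ else ξ)
    split_ifs <;> rfl
  proj := ContinuousMap.const Circle ()
  proj_z2 _ _ := rfl
  proj_circle _ _ := rfl
  locallyTrivial := circle_locallyTrivial

/-- `S¹_free → pt`: the circle with the involution `u ↦ -u`. -/
def circleFree : CircleBundle Unit where
  Total := Circle
  topology := inferInstance
  z2Action := involutionAction (fun u => -u) (fun u => neg_neg u)
  z2Continuous :=
    continuousConstSMul_involutionAction (fun u => -u) (fun u => neg_neg u) continuous_neg
  circleAction := Monoid.toMulAction Circle
  circleContinuous := inferInstance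
  actionsCommute := by
    let := involutionAction (X := Circle) (fun u => -u) (fun u => neg_neg u)
    refine ⟨fun g u ξ => ?_⟩
    change (if g = 1 then u * ξ else -(u * ξ)) = u * (if g = 1 then ξ else -ξ)
    split_ifs
    · rfl
    · exact (mul_neg u ξ).symm
  proj := ContinuousMap.const Circle ()
  proj_z2 _ _ := rfl
  proj_circle _ _ := rfl
  locallyTrivial := circle_locallyTrivial

/-- The group 2-cocycle `τ_{S¹}` of `ℤ₂` with values in `C(S¹_triv, U(1))`: `τ(-1, -1)` is the
identity function `u ↦ u`, and the other values are `1`. -/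
def tauCocycle : TwoCocycle circleTriv.Total where
  toFun g h := if g = -1 ∧ h = -1 then ContinuousMap.id Circle else ContinuousMap.const Circle 1
  cocycle g h k x := by
    have hx : g⁻¹ • x = x := by
      change (if g⁻¹ = 1 then x else id x) = x
      split_ifs <;> rfl
    rw [hx]
    have h1 : ¬ ((1 : ℤˣ) = -1) := by decide
    rcases Int.units_eq_one_or g with rfl | rfl <;>
      rcases Int.units_eq_one_or h with rfl | rfl <;>
        rcases Int.units_eq_one_or k with rfl | rfl <;> simp [h1]
    · exact (one_mul _).trans (mul_one _).symm
    · exact (mul_one _).trans (one_mul _).symm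

end EquivTDuality

end

/-!
The proof describes every Borel construction in sight through its universal cover. For a circle
bundle `E` over a point this cover is the contractible space `Eℤ₂ × ℝ`; for the point itself it is
`Eℤ₂ = S^∞`. Since simplices lift along coverings, the singular cochains of the base are the
invariant cochains of the cover, and the cochains of the cover form a cohomologically trivial module
over the deck group (`exists_sub_pull_deck`, `exists_add_pull_deck` for `ℤ₂`, and
`exists_pull_screw_sub` for the infinite cyclic deck group of `S¹_free`). With the acyclicity of
contractible spaces (`exists_cobd_eq`), all the cohomology that is needed comes from dimension
shifting, without excision or spectral sequences: `H³(ℝP^∞) = 0` (`exists_cobd_eq_three`), a class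
in `H²(ℝP^∞)` vanishes if its index is even (`HasIndex.exists_cobd_eq`), a product of two classes of
odd index in `H²(ℝP^∞)` is not zero (`HasIndex.even_mul`), and `H³_{ℤ₂}(S¹_free) = 0`
(`exists_cobd_eq_free`).

A bundle over a point is a circle on which `-1` acts by multiplication with a square root of `1`, so
it is `S¹_triv` or `S¹_free` (`iso_triv_or_free`). The Chern class of `S¹_triv` vanishes because
`ℝP^∞ × S¹ → ℝP^∞` has a section, and that of `S¹_free` is the generator `c` of `H²(ℝP^∞)`: the
primitive on `S^∞ × ℝ` of an angular cochain has period `1` under the square of the deck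
transformation, which forces an odd index (`odd_of_isAngular_free`).

The class `τ` is represented by `π^* c ∪ α` with `α` a closed angular cochain on `ℝP^∞ × S¹`; cup
products with the cochain of increments of the logarithm of the coordinate connect it with the group
cocycle `τ_{S¹}` (`tauCocycle_represents_tauClass`). Its push-forward is `c`. Conversely a class on
`S¹_triv` is `0` or `τ` if its push-forward is `0` or `c` (`eq_zero_of_isPushforward_zero`,
`eq_tauClass_of_isPushforward`), as angular cochains are unique up to coboundaries and cochains of
`ℝP^∞`. These facts determine the twists of T-dual pairs. Two copies of `S¹_free` are never dual: a
relation `d y = w ∪ β` with `w` and `β` of odd index would make `c²` vanish. Finally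
`(S¹_free, 0)` and `(S¹_triv, τ)` are dual because on the fibre product `π^* c` becomes the
coboundary of the angular cochain of `S¹_free` (`pullCoh_borelSnd_tauClass`).
-/

noncomputable section

namespace EquivTDuality

/-! ### Cochain calculus -/

section Calculus

variable {X Y Z : Type} [TopologicalSpace X] [TopologicalSpace Y] [TopologicalSpace Z]

theorem simplexMap_comp {l m n : ℕ} (f : Fin (m + 1) → Fin (n + 1))
    (g : Fin (l + 1) → Fin (m + 1)) :
    (simplexMap f).comp (simplexMap g) = simplexMap (f ∘ g) :=
  ContinuousMap.ext fun x => stdSimplex.map_comp_apply g f x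

theorem sing_comp_comp {l m n : ℕ} (σ : Sing n X) (f : Fin (m + 1) → Fin (n + 1))
    (g : Fin (l + 1) → Fin (m + 1)) :
    (σ.comp (simplexMap f)).comp (simplexMap g) = σ.comp (simplexMap (f ∘ g)) := by
  rw [ContinuousMap.comp_assoc, simplexMap_comp]

theorem cobd_apply (n : ℕ) (a : Cochain n X) (σ : Sing (n + 1) X) :
    cobd n a σ = ∑ i : Fin (n + 2), (-1) ^ (i : ℕ) * a (σ.comp (simplexMap i.succAbove)) := rfl

theorem pull_apply (n : ℕ) (f : C(X, Y)) (a : Cochain n Y) (σ : Sing n X) :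
    pull n f a σ = a (f.comp σ) := rfl

theorem pull_pull (n : ℕ) (f : C(X, Y)) (g : C(Y, Z)) (a : Cochain n Z) :
    pull n f (pull n g a) = pull n (g.comp f) a := rfl

theorem pull_cup {p q : ℕ} (f : C(X, Y)) (a : Cochain p Y) (b : Cochain q Y) :
    pull (p + q) f (cup a b) = cup (pull p f a) (pull q f b) := rfl

theorem cobd_cobd (n : ℕ) (a : Cochain n X) : cobd (n + 1) (cobd n a) = 0 := by
  funext σ
  simp only [cobd_apply, Finset.mul_sum, Pi.zero_apply, sing_comp_comp]
  rw [Finset.sum_comm, ← Finset.sum_product']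
  let P := Fin (n + 2) × Fin (n + 3)
  let S : Finset P := {ij : P | (ij.2 : ℕ) ≤ (ij.1 : ℕ)}
  rw [Finset.univ_product_univ, ← Finset.sum_add_sum_compl S, ← eq_neg_iff_add_eq_zero,
    ← Finset.sum_neg_distrib]
  let φ : ∀ ij : P, ij ∈ S → P := fun ij hij =>
    (Fin.castLT ij.2 (lt_of_le_of_lt (Finset.mem_filter.mp hij).right (Fin.is_lt ij.1)),
      ij.1.succ)
  apply Finset.sum_bij φ
  · intro ij hij
    simp_rw [S, φ, Finset.compl_filter, Finset.mem_filter_univ, Fin.val_succ,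
      Fin.val_castLT] at hij ⊢
    omega
  · rintro ⟨i, j⟩ hij ⟨i', j'⟩ hij' h
    obtain ⟨h1, h2⟩ := Prod.mk_inj.1 h
    have h1' := congrArg Fin.val h1
    have h2' := congrArg Fin.val h2
    simp only [Fin.val_castLT, Fin.val_succ] at h1' h2'
    exact Prod.ext (Fin.ext (by simpa using h2')) (Fin.ext h1')
  · rintro ⟨i', j'⟩ hij'
    simp_rw [S, Finset.compl_filter, Finset.mem_filter_univ, not_le] at hij'
    refine ⟨(⟨j' - 1, by omega⟩, Fin.castSucc i'), ?_, ?_⟩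
    · simp only [S, Finset.mem_filter_univ, Fin.val_castSucc]
      omega
    · refine Prod.ext (Fin.ext ?_) (Fin.ext ?_)
      · simp [φ]
      · simp only [φ, Fin.val_succ]
        omega
  · rintro ⟨i, j⟩ hij
    simp only [S, Finset.mem_filter_univ] at hij
    have hc : (j.succAbove ∘ i.succAbove : Fin (n + 1) → Fin (n + 3)) =
        i.succ.succAbove ∘ (Fin.castLT j (lt_of_le_of_lt hij i.is_lt)).succAbove := by
      funext k
      simp only [Function.comp_apply, Fin.ext_iff, Fin.succAbove, Fin.lt_def]
      split_ifs <;> simp_all <;> omega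
    simp only [φ, hc, Fin.val_succ, Fin.val_castLT, pow_succ]
    ring

/-- The Leibniz rule, evaluated on a simplex: in this form both terms on the right keep the degrees
`(p + 1, q)` and `(p, q + 1)`, which for numerals are definitionally those of cup products. -/
theorem cobd_cup_apply {p q : ℕ} (a : Cochain p X) (b : Cochain q X) (σ : Sing (p + q + 1) X) :
    cobd (p + q) (cup a b) σ =
      cobd p a (σ.comp (simplexMap (m := p + 1) (n := p + q + 1) fun i => ⟨i.val, by omega⟩)) *
          b (σ.comp (simplexMap (m := q) (n := p + q + 1) fun j => ⟨p + 1 + j.val, by omega⟩)) +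
        (-1) ^ p * (a (σ.comp (simplexMap (m := p) (n := p + q + 1) fun i => ⟨i.val, by omega⟩)) *
          cobd q b (σ.comp
            (simplexMap (m := q + 1) (n := p + q + 1) fun j => ⟨p + j.val, by omega⟩))) := by
  simp only [cobd_apply, cup, sing_comp_comp]
  rw [← (finCongr (by omega : (p + 1) + (q + 1) = p + q + 2)).sum_comp, Fin.sum_univ_add,
    Fin.sum_univ_castSucc (n := p + 1), Fin.sum_univ_succ (n := q + 1)]
  have key : ∀ {m : ℕ} {f g : Fin (m + 1) → Fin (p + q + 2)},
      (∀ k, (f k : ℕ) = g k) → σ.comp (simplexMap f) = σ.comp (simplexMap g) := by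
    intro m f g h
    rw [show f = g from funext fun k => Fin.ext (h k)]
  rw [add_mul, mul_add, mul_add, Finset.sum_mul, Finset.mul_sum, Finset.mul_sum]
  have e1 : ∀ x x' y y' z w : ℤ, x = x' → y = y' → z + w = 0 → x + y = (x' + z) + (w + y') := by
    intros; subst_vars; linarith
  apply e1
  · refine Finset.sum_congr rfl fun i _ => ?_
    rw [mul_assoc]
    congr 1
    congr 2
    · refine key fun k => ?_
      simp only [Function.comp_apply, Fin.succAbove, Fin.lt_def]
      split_ifs <;> simp_all
      omega
    · refine key fun k => ?_
      simp only [Function.comp_apply, Fin.succAbove, Fin.lt_def]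
      split_ifs <;> simp_all <;> omega
  · refine Finset.sum_congr rfl fun i _ => ?_
    have h1 : (-1 : ℤ) ^ (((finCongr (by omega : (p + 1) + (q + 1) = p + q + 2))
        (Fin.natAdd (p + 1) i) : Fin (p + q + 2)) : ℕ) =
        (-1) ^ p * (-1) ^ ((i.succ : Fin _) : ℕ) := by
      rw [← pow_add]
      congr 1
      simp
      omega
    rw [h1]
    rw [mul_assoc, mul_left_comm (a _)]
    congr 3
    · refine congrArg a (key fun k => ?_)
      simp only [Function.comp_apply, Fin.succAbove, Fin.lt_def]
      split_ifs <;> simp_all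
      omega
    · refine congrArg b (key fun k => ?_)
      simp only [Function.comp_apply, Fin.succAbove, Fin.lt_def]
      split_ifs <;> simp_all <;> omega
  · have h1 : σ.comp (simplexMap
        ((fun i : Fin (p + 1 + 1) => (⟨i.val, by omega⟩ : Fin (p + q + 2))) ∘
          (Fin.last (p + 1)).succAbove)) =
        σ.comp (simplexMap (m := p) (n := p + q + 1) fun i => ⟨i.val, by omega⟩) := by
      refine key fun k => ?_
      simp
    have h2 : σ.comp (simplexMap
        ((fun j : Fin (q + 1 + 1) => (⟨p + j.val, by omega⟩ : Fin (p + q + 2))) ∘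
          (0 : Fin (q + 2)).succAbove)) =
        σ.comp (simplexMap (m := q) (n := p + q + 1) fun j => ⟨p + 1 + j.val, by omega⟩) := by
      refine key fun k => ?_
      simp
      omega
    rw [h1, h2]
    simp only [Fin.val_last, pow_succ, Fin.val_zero, pow_zero]
    ring

end Calculus

/-! ### Contractible spaces are acyclic -/

section Cone

/-- The map `(s, t) ↦ (s, (1 - s) t)` collapsing the end `s = 1` of the prism `I × Δⁿ` to the
vertex `0` of `Δⁿ⁺¹`. -/
def coneMap (n : ℕ) : C(unitInterval × stdSimplex ℝ (Fin (n + 1)), stdSimplex ℝ (Fin (n + 2))) where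
  toFun p := ⟨Fin.cons (p.1 : ℝ) fun i => (1 - (p.1 : ℝ)) * p.2 i, by
    refine ⟨fun i => ?_, ?_⟩
    · refine Fin.cases ?_ (fun j => ?_) i
      · simpa using p.1.2.1
      · exact mul_nonneg (sub_nonneg.2 p.1.2.2) (p.2.2.1 j)
    · rw [Fin.sum_univ_succ]
      simp only [Fin.cons_zero, Fin.cons_succ]
      rw [← Finset.mul_sum, stdSimplex.sum_eq_one]
      ring⟩
  continuous_toFun := by
    refine Continuous.subtype_mk (continuous_pi fun i => ?_) _
    refine Fin.cases ?_ (fun j => ?_) i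
    · simp only [Fin.cons_zero]
      fun_prop
    · simp only [Fin.cons_succ]
      have : Continuous fun p : unitInterval × stdSimplex ℝ (Fin (n + 1)) => p.2 j :=
        (continuous_apply j).comp (continuous_subtype_val.comp continuous_snd)
      fun_prop

theorem coneMap_apply_zero (n : ℕ) (p) : coneMap n p 0 = p.1 := rfl

theorem coneMap_apply_succ (n : ℕ) (p) (i : Fin (n + 1)) :
    coneMap n p i.succ = (1 - (p.1 : ℝ)) * p.2 i := rfl

theorem coneMap_surjective (n : ℕ) : Function.Surjective (coneMap n) := by
  intro t
  have hs : t 0 + ∑ i : Fin (n + 1), t i.succ = 1 := by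
    rw [← Fin.sum_univ_succ]
    exact t.2.2
  have h0 : 0 ≤ t 0 := t.2.1 0
  by_cases h : t 0 = 1
  · refine ⟨(1, stdSimplex.vertex 0), stdSimplex.ext (funext fun i => ?_)⟩
    have hz : ∀ i : Fin (n + 1), t i.succ = 0 := by
      have : ∑ i : Fin (n + 1), t i.succ = 0 := by linarith
      exact fun i => (Finset.sum_eq_zero_iff_of_nonneg fun j _ => t.2.1 j.succ).1 this i
        (Finset.mem_univ i)
    refine Fin.cases ?_ (fun j => ?_) i
    · rw [coneMap_apply_zero, h]
      rfl
    · rw [coneMap_apply_succ, hz]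
      simp
  · have h1 : t 0 < 1 := lt_of_le_of_ne (stdSimplex.le_one t 0) h
    have h2 : 1 - t 0 ≠ 0 := by linarith
    refine ⟨(⟨t 0, h0, h1.le⟩, ⟨fun i => t i.succ / (1 - t 0), fun i => ?_, ?_⟩),
      stdSimplex.ext (funext fun i => ?_)⟩
    · exact div_nonneg (t.2.1 i.succ) (by linarith)
    · rw [← Finset.sum_div, div_eq_one_iff_eq h2]
      linarith
    · refine Fin.cases ?_ (fun j => ?_) i
      · rfl
      · rw [coneMap_apply_succ]
        exact mul_div_cancel₀ _ h2

theorem coneMap_isQuotientMap (n : ℕ) : Topology.IsQuotientMap (coneMap n) :=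
  (coneMap n).continuous.isClosedMap.isQuotientMap (coneMap n).continuous (coneMap_surjective n)

theorem simplexMap_apply {m n : ℕ} (f : Fin (m + 1) → Fin (n + 1)) (t) (j : Fin (n + 1)) :
    simplexMap f t j = ∑ i, if f i = j then t i else 0 := by
  change (stdSimplex.map f t) j = _
  rw [stdSimplex.map_coe, FunOnFinite.linearMap_apply_apply, Finset.sum_filter]

theorem simplexMap_coneMap {m n : ℕ} (f : Fin (m + 1) → Fin (n + 1))
    (g : Fin (m + 2) → Fin (n + 2)) (h0 : g 0 = 0) (hs : ∀ i, g (Fin.succ i) = (f i).succ)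
    (s : unitInterval) (t : stdSimplex ℝ (Fin (m + 1))) :
    simplexMap g (coneMap m (s, t)) = coneMap n (s, simplexMap f t) := by
  refine stdSimplex.ext (funext fun j => ?_)
  rw [simplexMap_apply, Fin.sum_univ_succ]
  simp only [h0, hs, coneMap_apply_zero, coneMap_apply_succ]
  refine Fin.cases ?_ (fun j => ?_) j
  · simp [coneMap_apply_zero, Fin.succ_ne_zero]
  · rw [coneMap_apply_succ, simplexMap_apply]
    simp [Finset.mul_sum, (Fin.succ_ne_zero _).symm]

theorem simplexMap_succ (n : ℕ) (t : stdSimplex ℝ (Fin (n + 1))) :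
    simplexMap Fin.succ t = coneMap n (0, t) := by
  refine stdSimplex.ext (funext fun j => ?_)
  rw [simplexMap_apply]
  refine Fin.cases ?_ (fun j => ?_) j
  · simp [coneMap_apply_zero, Fin.succ_ne_zero]
  · simp [coneMap_apply_succ]

variable {Y : Type} [TopologicalSpace Y] (H : C(unitInterval × Y, Y)) (y₀ : Y)
  (h1 : ∀ y, H (1, y) = y₀)

theorem factorsThrough_coneMap (H : C(unitInterval × Y, Y)) (y₀ : Y)
    (h1 : ∀ y, H (1, y) = y₀) {n : ℕ} (σ : Sing n Y) :
    Function.FactorsThrough (H.comp ((ContinuousMap.id unitInterval).prodMap σ)) (coneMap n) := by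
  rintro ⟨s, t⟩ ⟨s', t'⟩ h
  have hs : s = s' := by
    have := congrArg (fun x : stdSimplex ℝ (Fin (n + 2)) => x 0) h
    exact Subtype.ext this
  subst hs
  by_cases h' : (s : ℝ) = 1
  · obtain rfl : s = 1 := Subtype.ext h'
    exact (h1 _).trans (h1 _).symm
  · have ht : t = t' := by
      refine stdSimplex.ext (funext fun i => ?_)
      have := congrArg (fun x : stdSimplex ℝ (Fin (n + 2)) => x i.succ) h
      exact mul_left_cancel₀ (sub_ne_zero.2 (Ne.symm h')) this
    rw [ht]

/-- The cone on a simplex given by a contraction of the space. -/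
def coneSimplex {n : ℕ} (σ : Sing n Y) : Sing (n + 1) Y :=
  (coneMap_isQuotientMap n).lift
    (H.comp ((ContinuousMap.id unitInterval).prodMap σ)) (factorsThrough_coneMap H y₀ h1 σ)

theorem coneSimplex_coneMap {n : ℕ} (σ : Sing n Y) (s : unitInterval)
    (t : stdSimplex ℝ (Fin (n + 1))) :
    coneSimplex H y₀ h1 σ (coneMap n (s, t)) = H (s, σ t) :=
  congrArg (fun f : C(_, Y) => f (s, t))
    ((coneMap_isQuotientMap n).lift_comp
      (H.comp ((ContinuousMap.id unitInterval).prodMap σ)) (factorsThrough_coneMap H y₀ h1 σ))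

theorem coneSimplex_face_zero (h0 : ∀ y, H (0, y) = y) {n : ℕ} (σ : Sing n Y) :
    (coneSimplex H y₀ h1 σ).comp (simplexMap (Fin.succAbove 0)) = σ := by
  ext t
  have : (Fin.succAbove 0 : Fin (n + 1) → Fin (n + 2)) = Fin.succ := by
    funext i
    simp
  rw [ContinuousMap.comp_apply, this, simplexMap_succ, coneSimplex_coneMap, h0]

theorem coneSimplex_face_succ {n : ℕ} (σ : Sing (n + 1) Y) (i : Fin (n + 2)) :
    (coneSimplex H y₀ h1 σ).comp (simplexMap i.succ.succAbove) =
      coneSimplex H y₀ h1 (σ.comp (simplexMap i.succAbove)) := by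
  ext t
  obtain ⟨⟨s, t⟩, rfl⟩ := coneMap_surjective n t
  rw [ContinuousMap.comp_apply, simplexMap_coneMap i.succAbove i.succ.succAbove (by simp)
    (fun j => by simp), coneSimplex_coneMap, coneSimplex_coneMap, ContinuousMap.comp_apply]

theorem exists_contraction (Y : Type) [TopologicalSpace Y] [ContractibleSpace Y] :
    ∃ (H : C(unitInterval × Y, Y)) (y₀ : Y), (∀ y, H (0, y) = y) ∧ ∀ y, H (1, y) = y₀ := by
  obtain ⟨y₀, ⟨F⟩⟩ := id_nullhomotopic Y
  exact ⟨F.toContinuousMap, y₀, fun y => F.apply_zero y, fun y => F.apply_one y⟩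

/-- The cone operator is a contracting homotopy of the cochain complex in positive degrees. -/
theorem exists_cobd_eq [ContractibleSpace Y] {n : ℕ} (a : Cochain (n + 1) Y)
    (ha : cobd (n + 1) a = 0) : ∃ b : Cochain n Y, cobd n b = a := by
  obtain ⟨H, y₀, h0, h1⟩ := exists_contraction Y
  refine ⟨fun σ => a (coneSimplex H y₀ h1 σ), funext fun σ => ?_⟩
  have := congrFun ha (coneSimplex H y₀ h1 σ)
  rw [cobd_apply, Fin.sum_univ_succ, coneSimplex_face_zero H y₀ h1 h0] at this
  simp only [coneSimplex_face_succ, Fin.val_succ, pow_succ, Pi.zero_apply, Fin.val_zero, pow_zero,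
    one_mul, mul_neg, mul_one, neg_mul, Finset.sum_neg_distrib] at this
  rw [cobd_apply]
  linarith

theorem exists_const_of_cobd_eq_zero [ContractibleSpace Y] (a : Cochain 0 Y)
    (ha : cobd 0 a = 0) : ∃ N : ℤ, a = fun _ => N := by
  obtain ⟨H, y₀, h0, h1⟩ := exists_contraction Y
  refine ⟨a (ContinuousMap.const _ y₀), funext fun σ => ?_⟩
  have := congrFun ha (coneSimplex H y₀ h1 σ)
  rw [cobd_apply, Fin.sum_univ_two, coneSimplex_face_zero H y₀ h1 h0] at this
  have hf : (coneSimplex H y₀ h1 σ).comp (simplexMap (Fin.succAbove 1)) =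
      ContinuousMap.const _ y₀ := by
    ext t
    have ht : simplexMap (Fin.succAbove (1 : Fin 2)) t = coneMap 0 (1, t) := by
      refine stdSimplex.ext (funext fun j => ?_)
      rw [simplexMap_apply]
      fin_cases j
      · rw [Fin.sum_univ_one]
        simp [coneMap_apply_zero]
      · rw [Fin.sum_univ_one]
        simpa using (coneMap_apply_succ 0 (1, t) 0).symm
    rw [ContinuousMap.comp_apply, ht, coneSimplex_coneMap, h1]
    rfl
  rw [hf] at this
  simp at this
  linarith

end Cone

/-! ### Contractibility of the infinite sphere -/

section Sphere

local notation "ℓ²" => lp (fun _ : ℕ => ℝ) 2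

theorem hasSum_sq_norm (s : ℓ²) : HasSum (fun i => ‖s i‖ ^ (2 : ℝ)) (‖s‖ ^ (2 : ℝ)) := by
  simpa using lp.hasSum_norm (p := 2) (by norm_num) s

/-- The right shift `(s₀, s₁, …) ↦ (0, s₀, s₁, …)` as a plain map. -/
def shiftFun (s : ℓ²) : ℓ² :=
  ⟨fun n => Nat.casesOn n 0 fun k => s k, by
    refine memℓp_gen ?_
    rw [← summable_nat_add_iff 1]
    simpa using (hasSum_sq_norm s).summable⟩

theorem norm_shiftFun (s : ℓ²) : ‖shiftFun s‖ = ‖s‖ := by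
  have h2 := hasSum_sq_norm (shiftFun s)
  rw [← hasSum_nat_add_iff' 1] at h2
  have h3 := h2.unique (hasSum_sq_norm s)
  have hz : ∑ i ∈ Finset.range 1, ‖shiftFun s i‖ ^ (2 : ℝ) = 0 := by
    rw [Finset.sum_range_one]
    change ‖(0 : ℝ)‖ ^ (2 : ℝ) = 0
    simp
  rw [hz, sub_zero] at h3
  exact (Real.rpow_left_inj (norm_nonneg _) (norm_nonneg _) (by norm_num)).1 h3

/-- The right shift as a linear isometry. -/
def shift : ℓ² →ₗᵢ[ℝ] ℓ² where
  toFun := shiftFun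
  map_add' s t := by
    ext n
    cases n
    · exact (add_zero (0 : ℝ)).symm
    · rfl
  map_smul' c s := by
    ext n
    cases n
    · exact (mul_zero c).symm
    · rfl
  norm_map' := norm_shiftFun

theorem shift_zero (s : ℓ²) : shift s 0 = 0 := rfl

theorem shift_succ (s : ℓ²) (n : ℕ) : shift s (n + 1) = s n := rfl

/-- Radial projection of `ℓ² ∖ {0}` to the unit sphere. -/
def normalize (x : {x : ℓ² // x ≠ 0}) : Metric.sphere (0 : ℓ²) 1 :=
  ⟨‖x.1‖⁻¹ • x.1, by simp [norm_smul, inv_mul_cancel₀ (norm_ne_zero_iff.2 x.2)]⟩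

theorem continuous_normalize : Continuous normalize := by
  refine Continuous.subtype_mk (Continuous.smul (Continuous.inv₀
    (continuous_norm.comp continuous_subtype_val) ?_) continuous_subtype_val) _
  exact fun x => norm_ne_zero_iff.2 x.2

theorem normalize_of_norm_one (x : Metric.sphere (0 : ℓ²) 1) (h) : normalize ⟨x.1, h⟩ = x := by
  refine Subtype.ext ?_
  have : ‖x.1‖ = 1 := by simp
  simp [normalize, this]

/-- Maps to the sphere whose values are never opposite are homotopic, by radial projection of the
straight-line homotopy. -/
theorem homotopic_of_segment_ne_zero {A : Type} [TopologicalSpace A]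
    (f g : C(A, Metric.sphere (0 : ℓ²) 1))
    (h : ∀ (t : unitInterval) (a : A), (1 - (t : ℝ)) • (f a : ℓ²) + (t : ℝ) • (g a : ℓ²) ≠ 0) :
    f.Homotopic g :=
  ⟨{ toFun := fun p => normalize ⟨_, h p.1 p.2⟩
     continuous_toFun := continuous_normalize.comp (Continuous.subtype_mk (by fun_prop) _)
     map_zero_left := fun a => by simpa using normalize_of_norm_one (f a) _
     map_one_left := fun a => by simpa using normalize_of_norm_one (g a) _ }⟩

instance contractibleSpace_sphere : ContractibleSpace (Metric.sphere (0 : ℓ²) 1) := by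
  rw [contractible_iff_id_nullhomotopic]
  let e : Metric.sphere (0 : ℓ²) 1 := ⟨lp.single 2 0 (1 : ℝ), by simp [lp.norm_single]⟩
  let S : C(Metric.sphere (0 : ℓ²) 1, Metric.sphere (0 : ℓ²) 1) :=
    ⟨fun s => ⟨shift s.1, by simp⟩, by
      have h : Continuous fun s : Metric.sphere (0 : ℓ²) 1 => shift s.1 :=
        shift.continuous.comp continuous_subtype_val
      exact h.subtype_mk _⟩
  have hne : ∀ s : Metric.sphere (0 : ℓ²) 1, (s : ℓ²) ≠ 0 := by
    intro s h0
    have : ‖(s : ℓ²)‖ = 1 := by simp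
    rw [h0, norm_zero] at this
    exact zero_ne_one this
  refine ⟨e, (homotopic_of_segment_ne_zero (ContinuousMap.id _) S ?_).trans
    (homotopic_of_segment_ne_zero S (ContinuousMap.const _ e) ?_)⟩
  · intro t s h0
    -- comparing coordinates, the first non-zero coordinate of `s` would have to vanish
    have hc : ∀ n, (1 - (t : ℝ)) * (s : ℓ²) n + (t : ℝ) * shift (s : ℓ²) n = 0 := fun n =>
      congrArg (fun x : ℓ² => x n) h0
    refine hne s (lp.ext (funext fun n => ?_))
    by_cases ht : (t : ℝ) = 1
    · have := hc (n + 1)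
      rw [ht, shift_succ] at this
      simpa using this
    · have ht' : 1 - (t : ℝ) ≠ 0 := sub_ne_zero.2 (Ne.symm ht)
      induction n with
      | zero =>
        have := hc 0
        rw [shift_zero, mul_zero, add_zero] at this
        exact (mul_eq_zero.1 this).resolve_left ht'
      | succ k ih =>
        have := hc (k + 1)
        rw [shift_succ, ih] at this
        simp only [lp.coeFn_zero, Pi.zero_apply, mul_zero, add_zero] at this
        exact (mul_eq_zero.1 this).resolve_left ht'
  · intro t s h0
    have hc : ∀ n, (1 - (t : ℝ)) * shift (s : ℓ²) n + (t : ℝ) * (e : ℓ²) n = 0 := fun n =>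
      congrArg (fun x : ℓ² => x n) h0
    have h1 : (e : ℓ²) 0 = 1 :=
      lp.single_apply_self (E := fun _ : ℕ => ℝ) 2 0 (1 : ℝ)
    have ht : (t : ℝ) = 0 := by
      have := hc 0
      rwa [shift_zero, h1, mul_zero, zero_add, mul_one] at this
    rw [ht] at h0
    have h2 : shift (s : ℓ²) = 0 := by simpa [S] using h0
    exact hne s (by rw [← norm_eq_zero, ← shift.norm_map, h2, norm_zero])

instance : ContractibleSpace EZ2 :=
  inferInstanceAs (ContractibleSpace (Metric.sphere (0 : ℓ²) 1))

theorem exists_nhds_disjoint_antipode (s : EZ2) : ∃ U ∈ nhds s, ∀ x ∈ U, antipode x ∉ U := by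
  let s' : Metric.sphere (0 : ℓ²) 1 := s
  refine ⟨(Metric.ball s' 1 : Set (Metric.sphere (0 : ℓ²) 1)),
    Metric.ball_mem_nhds s' one_pos, fun x hx hx' => ?_⟩
  let x' : Metric.sphere (0 : ℓ²) 1 := x
  have h1 : dist x' s' < 1 := hx
  have h2 : dist (-x') s' < 1 := hx'
  have h3 : dist x' (-x') < 2 := by
    refine (dist_triangle_right x' (-x') s').trans_lt ?_
    linarith
  have h4 : dist x' (-x') = 2 := by
    have hn : ‖(x' : ℓ²)‖ = 1 := by simp
    rw [Subtype.dist_eq, dist_eq_norm]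
    have : (x' : ℓ²) - ((-x' : Metric.sphere (0 : ℓ²) 1) : ℓ²) = (2 : ℝ) • (x' : ℓ²) := by
      rw [two_smul]
      simp
    rw [this, norm_smul, hn]
    norm_num
  linarith

theorem antipode_ne (s : EZ2) : antipode s ≠ s := by
  obtain ⟨U, hU, h⟩ := exists_nhds_disjoint_antipode s
  intro hs
  exact h s (mem_of_mem_nhds hU) (by rw [hs]; exact mem_of_mem_nhds hU)

end Sphere

/-! ### Lifting simplices along coverings -/

section Lifting

variable {Y B : Type} [TopologicalSpace Y] [TopologicalSpace B]

instance (n : ℕ) : ContractibleSpace (stdSimplex ℝ (Fin (n + 1))) :=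
  (convex_stdSimplex ℝ (Fin (n + 1))).contractibleSpace
    ⟨_, single_mem_stdSimplex ℝ (0 : Fin (n + 1))⟩

/-- Simplices lift along coverings: a contraction of the simplex turns the lifting problem into
a homotopy lifting problem that starts at a constant map. -/
theorem exists_lift_of_isCoveringMap {p : C(Y, B)} (cov : IsCoveringMap p)
    (hp : Function.Surjective p) {n : ℕ} (σ : Sing n B) : ∃ σ' : Sing n Y, p.comp σ' = σ := by
  obtain ⟨H, y₀, h0, h1⟩ := exists_contraction (stdSimplex ℝ (Fin (n + 1)))
  obtain ⟨e, he⟩ := hp (σ y₀)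
  let G : C(unitInterval × stdSimplex ℝ (Fin (n + 1)), B) :=
    σ.comp (H.comp ((ContinuousMap.mk unitInterval.symm unitInterval.continuous_symm).prodMap
      (ContinuousMap.id _)))
  have hG : ∀ a, G (0, a) = p (ContinuousMap.const _ e a) := by
    intro a
    have : unitInterval.symm 0 = 1 := unitInterval.symm_zero
    simp [G, this, h1, he]
  refine ⟨(cov.liftHomotopy G _ hG).comp ((ContinuousMap.const _ 1).prodMk (ContinuousMap.id _)),
    ContinuousMap.ext fun a => ?_⟩
  have h := congrFun (cov.liftHomotopy_lifts G _ hG) (1, a)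
  have h' : unitInterval.symm 1 = 0 := unitInterval.symm_one
  have h2 : G (1, a) = σ a := by simp [G, h', h0]
  rw [← h2]
  exact h

theorem lift_unique {p : Y → B} (cov : IsCoveringMap p) {n : ℕ} {σ σ' : Sing n Y}
    (h : ∀ x, p (σ x) = p (σ' x)) (x₀) (h0 : σ x₀ = σ' x₀) : σ = σ' :=
  DFunLike.coe_injective (cov.eq_of_comp_eq σ.continuous σ'.continuous (funext h) x₀ h0)

theorem pull_injective {p : C(Y, B)} {n : ℕ} (hp : ∀ σ : Sing n B, ∃ σ' : Sing n Y, p.comp σ' = σ) :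
    Function.Injective (pull n p) := by
  intro a b h
  funext σ
  obtain ⟨σ', rfl⟩ := hp σ
  exact congrFun h σ'

theorem exists_pull_eq {p : C(Y, B)} {n : ℕ} (hp : ∀ σ : Sing n B, ∃ σ' : Sing n Y, p.comp σ' = σ)
    (a : Cochain n Y) (ha : ∀ σ σ', p.comp σ = p.comp σ' → a σ = a σ') :
    ∃ b : Cochain n B, pull n p b = a := by
  choose l hl using hp
  exact ⟨fun σ => a (l σ), funext fun σ => ha _ _ (hl _)⟩

end Lifting

/-! ### The double cover of the Borel construction -/

section DoubleCover

/-- A fundamental domain of the antipodal map: the indicator function of a set that contains exactly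
one of `s` and `-s`. -/
theorem exists_sheet : ∃ χ : EZ2 → ℤ, (∀ s, χ s = 0 ∨ χ s = 1) ∧ ∀ s, χ (antipode s) = 1 - χ s := by
  classical
  let r : EZ2 → EZ2 → Prop := WellOrderingRel
  refine ⟨fun s => if r s (antipode s) then 1 else 0, fun s => ?_, fun s => ?_⟩
  · dsimp only
    split_ifs <;> simp
  · dsimp only
    rw [antipode_involutive s]
    rcases trichotomous_of r s (antipode s) with h | h | h
    · rw [if_pos h, if_neg (asymm_of r h)]
      rfl
    · exact absurd h.symm (antipode_ne s)
    · rw [if_pos h, if_neg (asymm_of r h)]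
      rfl

/-- The indicator function of a fundamental domain of the antipodal map. -/
def sheet : EZ2 → ℤ := exists_sheet.choose

theorem sheet_eq (s : EZ2) : sheet s = 0 ∨ sheet s = 1 := exists_sheet.choose_spec.1 s

theorem sheet_antipode (s : EZ2) : sheet (antipode s) = 1 - sheet s := exists_sheet.choose_spec.2 s

theorem borelMk_surjective {X : Type} [TopologicalSpace X] [MulAction ℤˣ X] :
    Function.Surjective (borelMk X) := Quotient.mk_surjective

variable (X : Type) [TopologicalSpace X] [MulAction ℤˣ X] [ContinuousConstSMul ℤˣ X]

/-- The deck transformation of `Eℤ₂ × X → Eℤ₂ ×_{ℤ₂} X`. -/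
def deck : C(EZ2 × X, EZ2 × X) := ⟨fun y => (-1 : ℤˣ) • y, continuous_const_smul _⟩

variable {X}

theorem deck_deck (y : EZ2 × X) : deck X (deck X y) = y := by
  change (-1 : ℤˣ) • (-1 : ℤˣ) • y = y
  rw [smul_smul, neg_one_mul, neg_neg, one_smul]

theorem deck_comp_deck : (deck X).comp (deck X) = ContinuousMap.id _ :=
  ContinuousMap.ext deck_deck

theorem pull_deck_pull_deck {n : ℕ} (a : Cochain n (EZ2 × X)) :
    pull n (deck X) (pull n (deck X) a) = a := by
  rw [pull_pull, deck_comp_deck]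
  rfl

theorem borelMk_comp_deck : (borelMk X).comp (deck X) = borelMk X :=
  ContinuousMap.ext fun _ => Quotient.sound ⟨-1, rfl⟩

theorem pull_deck_pull_borelMk {n : ℕ} (a : Cochain n (Borel X)) :
    pull n (deck X) (pull n (borelMk X) a) = pull n (borelMk X) a := by
  rw [pull_pull, borelMk_comp_deck]

variable (X) in
theorem borelMk_isQuotientCoveringMap : IsQuotientCoveringMap (borelMk X) ℤˣ where
  toIsQuotientMap := isQuotientMap_quotient_mk'
  toContinuousConstSMul := inferInstance
  apply_eq_iff_mem_orbit := Quotient.eq''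
  disjoint y := by
    obtain ⟨U, hU, h⟩ := exists_nhds_disjoint_antipode y.1
    refine ⟨Prod.fst ⁻¹' U, continuous_fst.continuousAt.preimage_mem_nhds hU, fun g hg => ?_⟩
    obtain ⟨_, ⟨x, hx, rfl⟩, hx'⟩ := hg
    rcases Int.units_eq_one_or g with rfl | rfl
    · rfl
    · exact absurd hx' (h x.1 hx)

theorem borelMk_eq_iff (y y' : EZ2 × X) :
    borelMk X y = borelMk X y' ↔ y = y' ∨ y = deck X y' := by
  rw [(borelMk_isQuotientCoveringMap X).apply_eq_iff_mem_orbit, MulAction.mem_orbit_iff]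
  constructor
  · rintro ⟨g, rfl⟩
    rcases Int.units_eq_one_or g with rfl | rfl
    · exact Or.inl (one_smul _ _)
    · exact Or.inr rfl
  · rintro (rfl | rfl)
    · exact ⟨1, one_smul _ _⟩
    · exact ⟨-1, rfl⟩

theorem exists_lift_borel {n : ℕ} (σ : Sing n (Borel X)) :
    ∃ σ' : Sing n (EZ2 × X), (borelMk X).comp σ' = σ :=
  exists_lift_of_isCoveringMap (borelMk_isQuotientCoveringMap X).isCoveringMap borelMk_surjective σ

theorem lift_borel_eq {n : ℕ} {σ σ' : Sing n (EZ2 × X)}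
    (h : (borelMk X).comp σ = (borelMk X).comp σ') : σ = σ' ∨ σ = (deck X).comp σ' := by
  have hx : ∀ x, borelMk X (σ x) = borelMk X (σ' x) := fun x => congrArg (fun f : C(_, _) => f x) h
  have cov := (borelMk_isQuotientCoveringMap X).isCoveringMap
  rcases (borelMk_eq_iff _ _).1 (hx (stdSimplex.vertex 0)) with h0 | h0
  · exact Or.inl (lift_unique cov hx _ h0)
  · refine Or.inr (lift_unique cov (fun x => (hx x).trans ?_) _ h0)
    exact (congrArg (fun f : C(_, _) => f (σ' x)) borelMk_comp_deck).symm

theorem pull_borelMk_injective {n : ℕ} : Function.Injective (pull n (borelMk X)) :=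
  pull_injective exists_lift_borel

theorem exists_pull_borelMk_eq {n : ℕ} (a : Cochain n (EZ2 × X)) (ha : pull n (deck X) a = a) :
    ∃ b : Cochain n (Borel X), pull n (borelMk X) b = a := by
  refine exists_pull_eq exists_lift_borel a fun σ σ' h => ?_
  rcases lift_borel_eq h with rfl | rfl
  · rfl
  · exact congrFun ha σ'

/-- Multiplication of a cochain on `Eℤ₂ × X` by the indicator function of a fundamental domain,
evaluated at the initial vertex. It is a contraction showing that the cochains of `Eℤ₂ × X` are
a cohomologically trivial `ℤ₂`-module. -/
def cutoff {n : ℕ} (a : Cochain n (EZ2 × X)) : Cochain n (EZ2 × X) := fun σ =>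
  sheet (σ (stdSimplex.vertex 0)).1 * a σ

theorem pull_deck_cutoff {n : ℕ} (a : Cochain n (EZ2 × X)) :
    pull n (deck X) (cutoff a) = pull n (deck X) a - cutoff (pull n (deck X) a) := by
  funext σ
  change sheet (antipode (σ (stdSimplex.vertex 0)).1) * a ((deck X).comp σ) =
    a ((deck X).comp σ) - sheet (σ (stdSimplex.vertex 0)).1 * a ((deck X).comp σ)
  rw [sheet_antipode]
  ring

theorem exists_sub_pull_deck {n : ℕ} (a : Cochain n (EZ2 × X)) (ha : a + pull n (deck X) a = 0) :
    ∃ b : Cochain n (EZ2 × X), b - pull n (deck X) b = a := by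
  have h : pull n (deck X) a = -a := (neg_eq_of_add_eq_zero_right ha).symm
  refine ⟨cutoff a, ?_⟩
  rw [pull_deck_cutoff, h]
  funext σ
  simp [cutoff]

theorem exists_add_pull_deck {n : ℕ} (a : Cochain n (EZ2 × X)) (ha : pull n (deck X) a = a) :
    ∃ b : Cochain n (EZ2 × X), b + pull n (deck X) b = a := by
  refine ⟨cutoff a, ?_⟩
  rw [pull_deck_cutoff, ha]
  funext σ
  simp [cutoff]

end DoubleCover

/-! ### Logarithms of circle-valued functions -/

section Logarithms

theorem circleExp_eq_iff (x y : ℝ) :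
    Circle.exp (2 * Real.pi * x) = Circle.exp (2 * Real.pi * y) ↔ ∃ k : ℤ, x = y + k := by
  rw [Circle.exp_eq_exp]
  have hpi := Real.pi_pos
  refine exists_congr fun k => ⟨fun h => ?_, fun h => ?_⟩
  · have : 2 * Real.pi * (x - (y + k)) = 0 := by linear_combination h
    have h2 := (mul_eq_zero.1 this).resolve_left (by positivity)
    linarith
  · rw [h]
    ring

theorem exists_circleExp_eq (u : Circle) : ∃ x : ℝ, Circle.exp (2 * Real.pi * x) = u := by
  refine ⟨Complex.arg u / (2 * Real.pi), ?_⟩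
  rw [mul_div_cancel₀ _ (by positivity), Circle.exp_arg]

theorem exists_log {n : ℕ} (f : Sing n Circle) :
    ∃ r : C(stdSimplex ℝ (Fin (n + 1)), ℝ), ∀ p, Circle.exp (2 * Real.pi * r p) = f p := by
  obtain ⟨r, hr⟩ := exists_lift_of_isCoveringMap Circle.isCoveringMap_exp
    (fun u => ⟨_, Circle.exp_arg u⟩) f
  refine ⟨⟨fun p => r p / (2 * Real.pi), by fun_prop⟩, fun p => ?_⟩
  rw [← hr]
  simp [mul_div_cancel₀ (r p) (show (2 * Real.pi) ≠ 0 by positivity)]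

theorem log_unique {n : ℕ} (r r' : C(stdSimplex ℝ (Fin (n + 1)), ℝ))
    (h : ∀ p, Circle.exp (2 * Real.pi * r p) = Circle.exp (2 * Real.pi * r' p)) :
    ∃ k : ℤ, ∀ p, r p = r' p + k := by
  obtain ⟨k, hk⟩ := (circleExp_eq_iff _ _).1 (h (stdSimplex.vertex 0))
  refine ⟨k, fun p => ?_⟩
  let s : Sing n ℝ := ⟨fun p => 2 * Real.pi * r p, by fun_prop⟩
  let s' : Sing n ℝ := ⟨fun p => 2 * Real.pi * (r' p + k), by fun_prop⟩
  have hs : s = s' := by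
    refine lift_unique Circle.isCoveringMap_exp (fun x => ?_) (stdSimplex.vertex 0) ?_
    · exact (h x).trans ((circleExp_eq_iff _ _).2 ⟨-k, by push_cast; ring⟩)
    · exact congrArg (fun x => 2 * Real.pi * x) hk
  exact mul_left_cancel₀ (by positivity) (congrArg (fun f : C(_, ℝ) => f p) hs)

variable {Y Z : Type} [TopologicalSpace Y] [TopologicalSpace Z]

/-- The `0`-cochain given by an integer-valued function. -/
def ofFun (n : Y → ℤ) : Cochain 0 Y := fun σ => n (σ (stdSimplex.vertex 0))

theorem cobd_ofFun (n : Y → ℤ) (σ : Sing 1 Y) :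
    cobd 0 (ofFun n) σ = n (σ (stdSimplex.vertex 1)) - n (σ (stdSimplex.vertex 0)) := by
  rw [cobd_apply, Fin.sum_univ_two]
  have h : ∀ i : Fin 2, (σ.comp (simplexMap i.succAbove)) (stdSimplex.vertex 0) =
      σ (stdSimplex.vertex (i.succAbove 0)) := fun i =>
    congrArg σ (stdSimplex.map_vertex _ _)
  simp only [ofFun, h]
  simp
  ring

/-- `M` is the integral `1`-cochain measuring the difference between the increments of continuous
logarithms of `f` along paths and the increments of the (arbitrary) logarithm `A` of `f`. -/
def IsLogCochain (f : C(Y, Circle)) (A : Y → ℝ) (M : Cochain 1 Y) : Prop :=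
  ∀ (σ : Sing 1 Y) (r : C(stdSimplex ℝ (Fin 2), ℝ)),
    (∀ p, Circle.exp (2 * Real.pi * r p) = f (σ p)) →
      (r (stdSimplex.vertex 1) - r (stdSimplex.vertex 0)) -
        (A (σ (stdSimplex.vertex 1)) - A (σ (stdSimplex.vertex 0))) = (M σ : ℝ)

theorem exists_isLogCochain (f : C(Y, Circle)) (A : Y → ℝ)
    (hA : ∀ y, Circle.exp (2 * Real.pi * A y) = f y) : ∃ M, IsLogCochain f A M := by
  have key : ∀ σ : Sing 1 Y, ∃ m : ℤ, ∀ r : C(stdSimplex ℝ (Fin 2), ℝ),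
      (∀ p, Circle.exp (2 * Real.pi * r p) = f (σ p)) →
        (r (stdSimplex.vertex 1) - r (stdSimplex.vertex 0)) -
          (A (σ (stdSimplex.vertex 1)) - A (σ (stdSimplex.vertex 0))) = (m : ℝ) := by
    intro σ
    obtain ⟨r₀, hr₀⟩ := exists_log (f.comp σ)
    obtain ⟨k₁, hk₁⟩ := (circleExp_eq_iff _ _).1
      ((hr₀ (stdSimplex.vertex 1)).trans (hA (σ (stdSimplex.vertex 1))).symm)
    obtain ⟨k₀, hk₀⟩ := (circleExp_eq_iff _ _).1
      ((hr₀ (stdSimplex.vertex 0)).trans (hA (σ (stdSimplex.vertex 0))).symm)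
    refine ⟨k₁ - k₀, fun r hr => ?_⟩
    obtain ⟨k, hk⟩ := log_unique r r₀ fun p => (hr p).trans (hr₀ p).symm
    rw [hk, hk, hk₁, hk₀]
    push_cast
    ring
  choose M hM using key
  exact ⟨M, hM⟩

theorem IsLogCochain.unique {f : C(Y, Circle)} {A : Y → ℝ} {M M' : Cochain 1 Y}
    (h : IsLogCochain f A M) (h' : IsLogCochain f A M') : M = M' := by
  funext σ
  obtain ⟨r, hr⟩ := exists_log (f.comp σ)
  exact_mod_cast (h σ r hr).symm.trans (h' σ r hr)

theorem IsLogCochain.pull {f : C(Y, Circle)} {A : Y → ℝ} {M : Cochain 1 Y}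
    (h : IsLogCochain f A M) (g : C(Z, Y)) : IsLogCochain (f.comp g) (A ∘ g) (pull 1 g M) :=
  fun σ r hr => h (g.comp σ) r hr

theorem IsLogCochain.cobd_eq_zero {f : C(Y, Circle)} {A : Y → ℝ} {M : Cochain 1 Y}
    (h : IsLogCochain f A M) : cobd 1 M = 0 := by
  funext σ
  obtain ⟨r, hr⟩ := exists_log (f.comp σ)
  have hf : ∀ i : Fin 3, (M (σ.comp (simplexMap i.succAbove)) : ℝ) =
      (r (stdSimplex.vertex (i.succAbove 1)) - r (stdSimplex.vertex (i.succAbove 0))) -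
        (A (σ (stdSimplex.vertex (i.succAbove 1))) -
          A (σ (stdSimplex.vertex (i.succAbove 0)))) := by
    intro i
    have hv : ∀ j : Fin 2, simplexMap i.succAbove (stdSimplex.vertex j) =
        stdSimplex.vertex (i.succAbove j) := fun j => stdSimplex.map_vertex _ _
    rw [← h (σ.comp (simplexMap i.succAbove)) (r.comp (simplexMap i.succAbove)) fun p => hr _]
    simp only [ContinuousMap.comp_apply, hv]
  have : ((cobd 1 M σ : ℤ) : ℝ) = 0 := by
    rw [cobd_apply, Fin.sum_univ_three]
    push_cast
    rw [hf, hf, hf]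
    simp [show (2 : Fin 3).succAbove 1 = 1 from rfl, show (1 : Fin 3).succAbove 1 = 2 from rfl]
    ring
  exact_mod_cast this

/-- The logarithmic cochain after multiplying the function by a constant and changing the chosen
logarithm by an integer-valued function. -/
theorem IsLogCochain.change {f f' : C(Y, Circle)} {A A' : Y → ℝ} {M : Cochain 1 Y}
    (h : IsLogCochain f A M) (c : ℝ) (n : Y → ℤ)
    (hf : ∀ y, f' y = Circle.exp (2 * Real.pi * c) * f y) (hA : ∀ y, A' y = A y + c + n y) :
    IsLogCochain f' A' (M - cobd 0 (ofFun n)) := by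
  intro σ r hr
  have := h σ ⟨fun p => r p - c, by fun_prop⟩ (by
    intro p
    change Circle.exp (2 * Real.pi * (r p - c)) = _
    rw [mul_sub, Circle.exp_sub, hr, hf, mul_comm, mul_div_assoc, div_self', mul_one])
  simp only [ContinuousMap.coe_mk] at this
  rw [Pi.sub_apply, cobd_ofFun, hA, hA]
  push_cast
  linarith

end Logarithms

/-! ### Circle bundles over a point and their universal covers -/

section Coordinates

variable {E : CircleBundle Unit} (e : E.Total ≃ₜ Circle)

/-- The covering `Eℤ₂ × ℝ → Eℤ₂ × E` of the total space of a circle bundle over a point. -/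
def expCover : C(EZ2 × ℝ, EZ2 × E.Total) :=
  ⟨fun y => (y.1, e.symm (Circle.exp (2 * Real.pi * y.2))), by fun_prop⟩

/-- The universal cover `Eℤ₂ × ℝ` of the Borel construction of a circle bundle over a point. -/
def univCover : C(EZ2 × ℝ, Borel E.Total) := (borelMk E.Total).comp (expCover e)

theorem exists_lift_univCover {n : ℕ} (σ : Sing n (Borel E.Total)) :
    ∃ σ' : Sing n (EZ2 × ℝ), (univCover e).comp σ' = σ := by
  obtain ⟨σ', rfl⟩ := exists_lift_borel σ
  obtain ⟨r, hr⟩ := exists_log ((⟨e, e.continuous⟩ : C(E.Total, Circle)).comp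
    (ContinuousMap.snd.comp σ'))
  refine ⟨(ContinuousMap.fst.comp σ').prodMk r, ContinuousMap.ext fun p => ?_⟩
  refine congrArg (borelMk E.Total) (Prod.ext rfl ?_)
  change e.symm (Circle.exp (2 * Real.pi * r p)) = (σ' p).2
  rw [hr]
  exact e.symm_apply_apply _

/-- Two simplices of `Eℤ₂ × ℝ` with the same image differ by a deck transformation. The involution
of the circle is a rotation by `c`. -/
theorem univCover_eq {c : ℝ}
    (hc : ∀ η : E.Total, e ((-1 : ℤˣ) • η) = Circle.exp (2 * Real.pi * c) * e η)
    {n : ℕ} {σ σ' : Sing n (EZ2 × ℝ)} (h : (univCover e).comp σ = (univCover e).comp σ') :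
    ∃ k : ℤ, (∀ p, σ p = ((σ' p).1, (σ' p).2 + k)) ∨
      ∀ p, σ p = (antipode (σ' p).1, (σ' p).2 + c + k) := by
  rcases lift_borel_eq (σ := (expCover e).comp σ) (σ' := (expCover e).comp σ') h with h | h
  · have hp := fun p => congrArg (fun f : C(_, EZ2 × E.Total) => f p) h
    obtain ⟨k, hk⟩ := log_unique (ContinuousMap.snd.comp σ) (ContinuousMap.snd.comp σ')
      fun p => e.symm.injective (congrArg Prod.snd (hp p))
    have h1 := fun p => congrArg Prod.fst (hp p)
    exact ⟨k, Or.inl fun p => Prod.ext (h1 p) (hk p)⟩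
  · have hp := fun p => congrArg (fun f : C(_, EZ2 × E.Total) => f p) h
    obtain ⟨k, hk⟩ := log_unique (ContinuousMap.snd.comp σ)
      (⟨fun p => (σ' p).2 + c, by fun_prop⟩ : C(_, ℝ)) fun p => by
        have h2 : e.symm (Circle.exp (2 * Real.pi * (σ p).2)) =
          (-1 : ℤˣ) • e.symm (Circle.exp (2 * Real.pi * (σ' p).2)) := congrArg Prod.snd (hp p)
        have h3 := congrArg e h2
        rw [hc, e.apply_symm_apply, e.apply_symm_apply] at h3
        change Circle.exp (2 * Real.pi * (σ p).2) = Circle.exp (2 * Real.pi * ((σ' p).2 + c))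
        rw [h3, mul_add, Circle.exp_add, mul_comm]
    have h1 := fun p => congrArg Prod.fst (hp p)
    exact ⟨k, Or.inr fun p => Prod.ext (h1 p) (hk p)⟩

end Coordinates

/-! ### Vanishing of the third cohomology for the free circle -/

section FreeCircle

theorem neg_one_eq_circleExp : (-1 : Circle) = Circle.exp (2 * Real.pi * (1 / 2)) := by
  rw [show 2 * Real.pi * (1 / 2) = Real.pi by ring]
  refine Circle.ext ?_
  rw [Circle.coe_exp, Complex.exp_pi_mul_I]
  rfl

/-- The generator `(s, x) ↦ (-s, x + 1 / 2)` of the infinite cyclic deck group of the universal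
cover for the free circle. -/
def screw : (EZ2 × ℝ) ≃ₜ (EZ2 × ℝ) where
  toFun y := (antipode y.1, y.2 + 1 / 2)
  invFun y := (antipode y.1, y.2 - 1 / 2)
  left_inv y := Prod.ext (antipode_involutive y.1) (by simp)
  right_inv y := Prod.ext (antipode_involutive y.1) (by simp)
  continuous_toFun := (antipode_continuous.comp continuous_fst).prodMk (by fun_prop)
  continuous_invFun := (antipode_continuous.comp continuous_fst).prodMk (by fun_prop)

theorem screw_zpow_snd (k : ℤ) (y : EZ2 × ℝ) : ((screw ^ k) y).2 = y.2 + k / 2 := by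
  induction k with
  | zero => simp
  | succ k ih =>
    rw [add_comm, zpow_add, zpow_one]
    change ((screw ^ (k : ℤ)) y).2 + 1 / 2 = _
    rw [ih]
    push_cast
    ring
  | pred k ih =>
    rw [sub_eq_add_neg, add_comm, zpow_add, zpow_neg_one]
    change ((screw ^ (-(k : ℤ))) y).2 - 1 / 2 = _
    rw [ih]
    push_cast
    ring

theorem screw_zpow_two_mul (k : ℤ) (y : EZ2 × ℝ) : (screw ^ (2 * k)) y = (y.1, y.2 + k) := by
  refine Prod.ext ?_ ?_
  · induction k with
    | zero => simp
    | succ k ih =>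
      rw [mul_add, mul_one, add_comm, zpow_add, zpow_two]
      change antipode (antipode ((screw ^ (2 * (k : ℤ))) y).1) = _
      rw [ih, antipode_involutive]
    | pred k ih =>
      rw [mul_sub, mul_one, sub_eq_add_neg, add_comm, zpow_add, zpow_neg, zpow_two, mul_inv_rev]
      change antipode (antipode ((screw ^ (2 * (-(k : ℤ)))) y).1) = _
      rw [ih, antipode_involutive]
  · rw [screw_zpow_snd]
    push_cast
    ring

/-- The `k`-fold screw translate of a singular simplex. -/
def screwPow {n : ℕ} (k : ℤ) (σ : Sing n (EZ2 × ℝ)) : Sing n (EZ2 × ℝ) :=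
  ((screw ^ k : (EZ2 × ℝ) ≃ₜ (EZ2 × ℝ)) : C(EZ2 × ℝ, EZ2 × ℝ)).comp σ

theorem screwPow_screwPow {n : ℕ} (k l : ℤ) (σ : Sing n (EZ2 × ℝ)) :
    screwPow k (screwPow l σ) = screwPow (k + l) σ := by
  simp only [screwPow, zpow_add]
  rfl

theorem screwPow_zero {n : ℕ} (σ : Sing n (EZ2 × ℝ)) : screwPow 0 σ = σ := rfl

theorem apply_screwPow {n : ℕ} {a : Cochain n (EZ2 × ℝ)} (ha : pull n screw a = a) (k : ℤ)
    (σ : Sing n (EZ2 × ℝ)) : a (screwPow k σ) = a σ := by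
  have h1 : ∀ σ, a (screwPow 1 σ) = a σ := fun σ => by
    rw [screwPow, zpow_one]
    exact congrFun ha σ
  induction k with
  | zero => rfl
  | succ k ih => rw [add_comm, ← screwPow_screwPow, h1, ih]
  | pred k ih => rw [← ih, ← h1 (screwPow _ σ), screwPow_screwPow, add_sub_cancel]

theorem exists_int_primitive (g : ℤ → ℤ) : ∃ G : ℤ → ℤ, ∀ k, G (k + 1) - G k = g k := by
  refine ⟨fun k => ∑ i ∈ Finset.range k.toNat, g i -
    ∑ i ∈ Finset.range (-k).toNat, g (-(i + 1)), fun k => ?_⟩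
  obtain ⟨m, rfl | rfl⟩ := k.eq_nat_or_neg
  · have h1 : ((m : ℤ) + 1).toNat = m + 1 := by omega
    have h2 : (-((m : ℤ) + 1)).toNat = 0 := by omega
    have h3 : (-(m : ℤ)).toNat = 0 := by omega
    simp only [h1, h2, h3, Int.toNat_natCast, Finset.sum_range_succ]
    ring
  · cases m with
    | zero => simp
    | succ m =>
      have h1 : (-((m + 1 : ℕ) : ℤ) + 1).toNat = 0 := by omega
      have h2 : (-(-((m + 1 : ℕ) : ℤ) + 1)).toNat = m := by omega
      have h3 : (-(-((m + 1 : ℕ) : ℤ))).toNat = m + 1 := by omega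
      have h4 : (-((m + 1 : ℕ) : ℤ)).toNat = 0 := by omega
      simp only [h1, h2, h3, h4, Finset.sum_range_succ]
      push_cast
      ring

/-- The cochains of `Eℤ₂ × ℝ` are a coinduced module for the infinite cyclic deck group. -/
theorem exists_pull_screw_sub {n : ℕ} (f : Cochain n (EZ2 × ℝ)) :
    ∃ b : Cochain n (EZ2 × ℝ), pull n screw b - b = f := by
  choose G hG using fun ρ : Sing n (EZ2 × ℝ) => exists_int_primitive fun k => f (screwPow k ρ)
  let m : Sing n (EZ2 × ℝ) → ℤ := fun σ => ⌊2 * (σ (stdSimplex.vertex 0)).2⌋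
  have hm : ∀ σ, m (screwPow 1 σ) = m σ + 1 := by
    intro σ
    change ⌊2 * ((screw ^ (1 : ℤ)) (σ (stdSimplex.vertex 0))).2⌋ = _
    rw [screw_zpow_snd, mul_add, Int.cast_one, mul_one_div_cancel two_ne_zero, Int.floor_add_one]
  refine ⟨fun σ => G (screwPow (-m σ) σ) (m σ), funext fun σ => ?_⟩
  change G (screwPow (-m (screwPow 1 σ)) (screwPow 1 σ)) (m (screwPow 1 σ)) -
    G (screwPow (-m σ) σ) (m σ) = f σ
  rw [screwPow_screwPow, hm, show -(m σ + 1) + 1 = -m σ by ring, hG, screwPow_screwPow,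
    add_neg_cancel, screwPow_zero]

/-- The tautological coordinate on `S¹_free`. -/
def freeCoord : circleFree.Total ≃ₜ Circle := Homeomorph.refl Circle

theorem freeCoord_smul (η : circleFree.Total) :
    freeCoord ((-1 : ℤˣ) • η) = Circle.exp (2 * Real.pi * (1 / 2)) * freeCoord η := by
  rw [← neg_one_eq_circleExp]
  exact (neg_one_mul (freeCoord η)).symm

/-- The universal cover for the free circle. -/
def freeCover : C(EZ2 × ℝ, Borel circleFree.Total) := univCover freeCoord

theorem freeCover_comp_screw : freeCover.comp (screw : C(EZ2 × ℝ, EZ2 × ℝ)) = freeCover := by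
  refine ContinuousMap.ext fun y => ((borelMk_eq_iff (X := circleFree.Total) _ _).2 (Or.inr ?_))
  refine Prod.ext rfl ?_
  change Circle.exp (2 * Real.pi * (y.2 + 1 / 2)) = -Circle.exp (2 * Real.pi * y.2)
  rw [mul_add, Circle.exp_add, ← neg_one_eq_circleExp, mul_neg_one]

theorem exists_pull_freeCover_eq {n : ℕ} (a : Cochain n (EZ2 × ℝ)) (ha : pull n screw a = a) :
    ∃ b : Cochain n (Borel circleFree.Total), pull n freeCover b = a := by
  refine exists_pull_eq (exists_lift_univCover freeCoord) a fun σ σ' h => ?_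
  obtain ⟨k, hk | hk⟩ := univCover_eq freeCoord freeCoord_smul h
  · rw [← apply_screwPow ha (2 * k) σ']
    congr 1
    ext1 p
    exact (hk p).trans (screw_zpow_two_mul k _).symm
  · rw [← apply_screwPow ha (1 + 2 * k) σ', screwPow, zpow_add, zpow_one]
    congr 1
    ext1 p
    rw [hk p]
    change _ = screw ((screw ^ (2 * k)) (σ' p))
    rw [screw_zpow_two_mul]
    exact Prod.ext rfl (by simp [screw]; ring)

/-- The cohomology of `Eℤ₂ ×_{ℤ₂} S¹_free` vanishes above degree `1`: it is the quotient of
a contractible space by a free action of an infinite cyclic group, whose cohomology vanishes above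
degree `1`. -/
theorem exists_cobd_eq_free {n : ℕ} (z : Cochain (n + 2) (Borel circleFree.Total))
    (hz : cobd (n + 2) z = 0) : ∃ y, cobd (n + 1) y = z := by
  obtain ⟨y, hy⟩ := exists_cobd_eq (pull (n + 2) freeCover z) (by rw [cobd_pull, hz, map_zero])
  obtain ⟨x, hx⟩ := exists_cobd_eq (pull (n + 1) screw y - y) (by
    rw [map_sub, cobd_pull, hy, pull_pull, freeCover_comp_screw, sub_self])
  obtain ⟨v, hv⟩ := exists_pull_screw_sub x
  obtain ⟨b, hb⟩ := exists_pull_freeCover_eq (y - cobd n v) (by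
    have : pull (n + 1) screw (cobd n v) - cobd n v = pull (n + 1) screw y - y := by
      rw [← cobd_pull, ← map_sub, hv, hx]
    rw [map_sub]
    linear_combination (exp := 1) -this)
  have inj : Function.Injective (pull (n + 2) freeCover) :=
    pull_injective (exists_lift_univCover freeCoord)
  refine ⟨b, inj ?_⟩
  rw [← cobd_pull, hb, map_sub, hy, cobd_cobd, sub_zero]

end FreeCircle

/-! ### Cup products in low degrees -/

section CupProducts

variable {X : Type} [TopologicalSpace X]

theorem cup_add {p q : ℕ} (a : Cochain p X) (b b' : Cochain q X) :
    cup a (b + b') = cup a b + cup a b' := by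
  funext σ
  simp [cup, mul_add]

theorem cup_neg {p q : ℕ} (a : Cochain p X) (b : Cochain q X) : cup a (-b) = -cup a b := by
  funext σ
  simp [cup]

theorem cup_zero {p q : ℕ} (a : Cochain p X) : cup a (0 : Cochain q X) = 0 := by
  funext σ
  simp [cup]

theorem add_cup {p q : ℕ} (a a' : Cochain p X) (b : Cochain q X) :
    cup (a + a') b = cup a b + cup a' b := by
  funext σ
  simp [cup, add_mul]

theorem sub_cup {p q : ℕ} (a a' : Cochain p X) (b : Cochain q X) :
    cup (a - a') b = cup a b - cup a' b := by
  funext σ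
  simp [cup, sub_mul]

theorem neg_cup {p q : ℕ} (a : Cochain p X) (b : Cochain q X) : cup (-a) b = -cup a b := by
  funext σ
  simp [cup]

theorem zero_cup {p q : ℕ} (b : Cochain q X) : cup (0 : Cochain p X) b = 0 := by
  funext σ
  simp [cup]

theorem const_cup {q : ℕ} (N : ℤ) (b : Cochain q X) (σ : Sing (0 + q) X) :
    cup (fun _ => N : Cochain 0 X) b σ =
      N * b (σ.comp (simplexMap (m := q) (n := 0 + q) fun j => ⟨0 + j.val, by omega⟩)) := rfl

theorem simplexMap_id (n : ℕ) : simplexMap (id : Fin (n + 1) → Fin (n + 1)) = ContinuousMap.id _ :=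
  ContinuousMap.ext fun x => stdSimplex.map_id_apply x

theorem const_cup_two (N : ℤ) (b : Cochain 2 X) :
    (cup (fun _ => N : Cochain 0 X) b : Cochain 2 X) = N • b := by
  funext σ
  refine (const_cup N b σ).trans ?_
  have h : (fun j : Fin 3 => (⟨0 + j.val, by omega⟩ : Fin 3)) = id :=
    funext fun j => Fin.ext (by simp)
  change N * b (σ.comp (simplexMap fun j : Fin 3 => (⟨0 + j.val, by omega⟩ : Fin 3))) = N * b σ
  rw [h, simplexMap_id, ContinuousMap.comp_id]

theorem const_cup_one (N : ℤ) (b : Cochain 1 X) :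
    (cup (fun _ => N : Cochain 0 X) b : Cochain 1 X) = N • b := by
  funext σ
  refine (const_cup N b σ).trans ?_
  have h : (fun j : Fin 2 => (⟨0 + j.val, by omega⟩ : Fin 2)) = id :=
    funext fun j => Fin.ext (by simp)
  change N * b (σ.comp (simplexMap fun j : Fin 2 => (⟨0 + j.val, by omega⟩ : Fin 2))) = N * b σ
  rw [h, simplexMap_id, ContinuousMap.comp_id]

theorem cobd_cup_zero_one (a : Cochain 0 X) (b : Cochain 1 X) :
    (cobd 1 (cup a b) : Cochain 2 X) = cup (cobd 0 a) b + cup a (cobd 1 b) :=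
  funext fun σ => (cobd_cup_apply a b σ).trans (by rw [pow_zero, one_mul]; rfl)

theorem cobd_cup_zero_two (a : Cochain 0 X) (b : Cochain 2 X) :
    (cobd 2 (cup a b) : Cochain 3 X) = cup (cobd 0 a) b + cup a (cobd 2 b) :=
  funext fun σ => (cobd_cup_apply a b σ).trans (by rw [pow_zero, one_mul]; rfl)

theorem cobd_cup_one_one (a : Cochain 1 X) (b : Cochain 1 X) :
    (cobd 2 (cup a b) : Cochain 3 X) = cup (cobd 1 a) b - cup a (cobd 1 b) :=
  funext fun σ => (cobd_cup_apply a b σ).trans (by rw [pow_one, neg_one_mul, ← sub_eq_add_neg]; rfl)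

theorem cobd_cup_one_two (a : Cochain 1 X) (b : Cochain 2 X) :
    (cobd 3 (cup a b) : Cochain 4 X) = cup (cobd 1 a) b - cup a (cobd 2 b) :=
  funext fun σ => (cobd_cup_apply a b σ).trans (by rw [pow_one, neg_one_mul, ← sub_eq_add_neg]; rfl)

theorem cobd_cup_two_zero (a : Cochain 2 X) (b : Cochain 0 X) :
    (cobd 2 (cup a b) : Cochain 3 X) = cup (cobd 2 a) b + cup a (cobd 0 b) :=
  funext fun σ => (cobd_cup_apply a b σ).trans (by rw [neg_one_sq, one_mul]; rfl)

theorem cobd_cup_two_one (a : Cochain 2 X) (b : Cochain 1 X) :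
    (cobd 3 (cup a b) : Cochain 4 X) = cup (cobd 2 a) b + cup a (cobd 1 b) :=
  funext fun σ => (cobd_cup_apply a b σ).trans (by rw [neg_one_sq, one_mul]; rfl)

end CupProducts

/-! ### Low-dimensional cohomology of infinite real projective space -/

section ProjectiveSpace

variable {X : Type} [TopologicalSpace X] [MulAction ℤˣ X] [ContinuousConstSMul ℤˣ X]

/-- `w` is represented, in the double complex of group cochains of `ℤ₂` with values in the cochains
of `Eℤ₂ × X`, by the constant `N` in bidegree `(2, 0)`. The parity of `N` is the class of `w` in
`H²(ℤ₂; ℤ) = ℤ/2`. -/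
def HasIndex (w : Cochain 2 (Borel X)) (N : ℤ) : Prop :=
  ∃ (a : Cochain 1 (EZ2 × X)) (b : Cochain 0 (EZ2 × X)),
    cobd 1 a = pull 2 (borelMk X) w ∧ cobd 0 b = a - pull 1 (deck X) a ∧
      b + pull 0 (deck X) b = fun _ => N

theorem HasIndex.sub {w w' : Cochain 2 (Borel X)} {N N' : ℤ} (h : HasIndex w N)
    (h' : HasIndex w' N') : HasIndex (w - w') (N - N') := by
  obtain ⟨a, b, h1, h2, h3⟩ := h
  obtain ⟨a', b', h1', h2', h3'⟩ := h'
  refine ⟨a - a', b - b', by rw [map_sub, map_sub, h1, h1'], ?_, ?_⟩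
  · rw [map_sub, map_sub, h2, h2']
    abel
  · rw [map_sub, sub_add_sub_comm, h3, h3']
    rfl

theorem HasIndex.exists_cobd_eq {w : Cochain 2 (Borel X)} {N : ℤ} (h : HasIndex w N)
    (hN : Even N) : ∃ v, cobd 1 v = w := by
  obtain ⟨a, b, h1, h2, h3⟩ := h
  obtain ⟨m, rfl⟩ := hN
  obtain ⟨f, hf⟩ := exists_sub_pull_deck (b - fun _ => m) (by
    funext σ
    have := congrFun h3 σ
    simp only [Pi.add_apply, pull_apply, Pi.sub_apply, Pi.zero_apply] at this ⊢
    linarith)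
  have hm : cobd 0 (fun _ => m : Cochain 0 (EZ2 × X)) = 0 := by
    funext σ
    simp [cobd_apply, Fin.sum_univ_two]
  obtain ⟨v, hv⟩ := exists_pull_borelMk_eq (a - cobd 0 f) (by
    have : a - pull 1 (deck X) a = cobd 0 f - pull 1 (deck X) (cobd 0 f) := by
      rw [← cobd_pull, ← map_sub, hf, map_sub, hm, sub_zero, h2]
    rw [map_sub]
    linear_combination (exp := 1) -this)
  refine ⟨v, pull_borelMk_injective ?_⟩
  rw [← cobd_pull, hv, map_sub, h1, cobd_cobd, sub_zero]

variable [ContractibleSpace X]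

theorem exists_hasIndex (w : Cochain 2 (Borel X)) (hw : cobd 2 w = 0) : ∃ N, HasIndex w N := by
  obtain ⟨a, ha⟩ := exists_cobd_eq (pull 2 (borelMk X) w) (by rw [cobd_pull, hw, map_zero])
  obtain ⟨b, hb⟩ := exists_cobd_eq (a - pull 1 (deck X) a) (by
    rw [map_sub, cobd_pull, ha, pull_deck_pull_borelMk, sub_self])
  obtain ⟨N, hN⟩ := exists_const_of_cobd_eq_zero (b + pull 0 (deck X) b) (by
    rw [map_add, cobd_pull, hb, map_sub, pull_deck_pull_deck]
    abel)
  exact ⟨N, a, b, ha, hb, hN⟩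

/-- `H³(ℝP^∞; ℤ) = 0`, by shifting dimension down to `H³(ℤ₂; ℤ) = 0`. -/
theorem exists_cobd_eq_three (z : Cochain 3 (Borel X)) (hz : cobd 3 z = 0) :
    ∃ y, cobd 2 y = z := by
  obtain ⟨y₁, hy₁⟩ := exists_cobd_eq (pull 3 (borelMk X) z) (by rw [cobd_pull, hz, map_zero])
  obtain ⟨y₀, hy₀⟩ := exists_cobd_eq (y₁ - pull 2 (deck X) y₁) (by
    rw [map_sub, cobd_pull, hy₁, pull_deck_pull_borelMk, sub_self])
  obtain ⟨c₀, hc₀⟩ := exists_cobd_eq (y₀ + pull 1 (deck X) y₀) (by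
    rw [map_add, cobd_pull, hy₀, map_sub, pull_deck_pull_deck]
    abel)
  obtain ⟨K, hK⟩ := exists_const_of_cobd_eq_zero (c₀ - pull 0 (deck X) c₀) (by
    rw [map_sub, cobd_pull, hc₀, map_add, pull_deck_pull_deck]
    abel)
  have hK0 : K = 0 := by
    have h1 := congrArg (pull 0 (deck X)) hK
    rw [map_sub, pull_deck_pull_deck] at h1
    let σ : Sing 0 (EZ2 × X) := ContinuousMap.const _ (Classical.arbitrary _)
    have h2 := congrFun hK σ
    have h3 := congrFun h1 σ
    simp only [Pi.sub_apply, pull_apply] at h2 h3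
    linarith
  obtain ⟨u, hu⟩ := exists_add_pull_deck c₀ (by
    rw [hK0] at hK
    exact (sub_eq_zero.1 hK).symm)
  obtain ⟨f, hf⟩ := exists_sub_pull_deck (y₀ - cobd 0 u) (by
    rw [map_sub, ← cobd_pull, ← add_sub_add_comm, ← map_add, hu, hc₀, sub_self])
  obtain ⟨b, hb⟩ := exists_pull_borelMk_eq (y₁ - cobd 1 f) (by
    have : y₁ - pull 2 (deck X) y₁ = cobd 1 f - pull 2 (deck X) (cobd 1 f) := by
      rw [← cobd_pull, ← map_sub, hf, map_sub, cobd_cobd, sub_zero, hy₀]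
    rw [map_sub]
    linear_combination (exp := 1) -this)
  refine ⟨b, pull_borelMk_injective ?_⟩
  rw [← cobd_pull, hb, map_sub, hy₁, cobd_cobd, sub_zero]

/-- The square of the generator of `H²(ℝP^∞; ℤ)` does not vanish: if a product of two classes is
zero, one of the two indices is even. The product is traced through the double complex down to the
constant `N * N'` in bidegree `(4, 0)`, which a primitive of the product makes even. -/
theorem HasIndex.even_mul {w β : Cochain 2 (Borel X)} {N N' : ℤ} (h : HasIndex w N)
    (h' : HasIndex β N') (hβ : cobd 2 β = 0) {y : Cochain 3 (Borel X)}
    (hy : cobd 3 y = (cup w β : Cochain 4 (Borel X))) : Even (N * N') := by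
  obtain ⟨a, b, h1, h2, h3⟩ := h
  obtain ⟨a', b', h1', h2', h3'⟩ := h'
  let P := pull 2 (borelMk X) β
  have hP : cobd 2 P = 0 := by rw [cobd_pull, hβ, map_zero]
  have hT : pull 2 (deck X) P = P := pull_deck_pull_borelMk β
  obtain ⟨q₂, hq₂⟩ := EquivTDuality.exists_cobd_eq
    ((cup a P : Cochain 3 _) - pull 3 (borelMk X) y) (by
      rw [map_sub, cobd_cup_one_two, hP, h1, cup_zero, sub_zero, cobd_pull, hy]
      exact sub_self _)
  have hTa : pull 3 (deck X) (cup a P : Cochain 3 _) = cup (pull 1 (deck X) a) P := by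
    conv_rhs => rw [← hT]
    rfl
  have hTb : pull 2 (deck X) (cup b P : Cochain 2 _) = cup (pull 0 (deck X) b) P := by
    conv_rhs => rw [← hT]
    rfl
  obtain ⟨q₁, hq₁⟩ := EquivTDuality.exists_cobd_eq
    ((cup b P : Cochain 2 _) - (q₂ - pull 2 (deck X) q₂)) (by
      rw [map_sub, map_sub, cobd_cup_zero_two, hP, cobd_pull, hq₂, h2, cup_zero, map_sub, hTa,
        pull_deck_pull_borelMk, sub_cup]
      simp only [add_zero]
      abel)
  have e1 : cobd 1 (q₁ + pull 1 (deck X) q₁) = N • P := by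
    rw [map_add, cobd_pull, hq₁, map_sub, map_sub, pull_deck_pull_deck, hTb, ← const_cup_two, ← h3,
      add_cup]
    abel
  obtain ⟨q₀, hq₀⟩ := EquivTDuality.exists_cobd_eq (N • a' - (q₁ + pull 1 (deck X) q₁)) (by
    rw [map_sub, map_zsmul, h1', e1, sub_self])
  obtain ⟨K, hK⟩ := exists_const_of_cobd_eq_zero (N • b' - (q₀ - pull 0 (deck X) q₀)) (by
    rw [map_sub, map_sub, map_zsmul, cobd_pull, hq₀, h2']
    simp only [map_sub, map_add, map_zsmul, pull_deck_pull_deck, smul_sub]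
    abel)
  let σ : Sing 0 (EZ2 × X) := ContinuousMap.const _ (Classical.arbitrary _)
  have k1 := congrFun hK σ
  have k2 := congrFun hK ((deck X).comp σ)
  have k3 := congrFun h3' σ
  have k4 : q₀ ((deck X).comp ((deck X).comp σ)) = q₀ σ :=
    congrFun (pull_deck_pull_deck q₀) σ
  simp only [Pi.sub_apply, Pi.smul_apply, Pi.add_apply, pull_apply, smul_eq_mul] at k1 k2 k3
  rw [k4] at k2
  refine ⟨K, ?_⟩
  rw [← k3]
  linarith

end ProjectiveSpace

/-! ### Cohomology classes -/

section Classes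

variable {X Y : Type} [TopologicalSpace X] [TopologicalSpace Y]

theorem cls_eq_cls_iff {n : ℕ} {z z' : cocycles (n + 1) X} :
    cls z = cls z' ↔ ∃ a, cobd n a = (z : Cochain (n + 1) X) - (z' : Cochain (n + 1) X) := by
  rw [eq_comm]
  refine QuotientAddGroup.eq.trans (Iff.trans AddSubgroup.mem_addSubgroupOf ?_)
  change (∃ a, cobd n a = -(z' : Cochain (n + 1) X) + (z : Cochain (n + 1) X)) ↔ _
  simp only [neg_add_eq_sub]

theorem cls_eq_zero_iff {n : ℕ} {z : cocycles (n + 1) X} :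
    cls z = 0 ↔ ∃ a, cobd n a = (z : Cochain (n + 1) X) := by
  have := cls_eq_cls_iff (z := z) (z' := 0)
  rw [ZeroMemClass.coe_zero, sub_zero] at this
  exact this

theorem pullCoh_cls (n : ℕ) (f : C(X, Y)) (z : cocycles n Y) :
    pullCoh n f (cls z) = cls (pullCocycles n f z) := rfl

theorem coe_pullCocycles (n : ℕ) (f : C(X, Y)) (z : cocycles n Y) :
    (pullCocycles n f z : Cochain n X) = pull n f z := rfl

theorem cls_surjective {n : ℕ} (h : Coh n X) : ∃ z, cls z = h := QuotientAddGroup.mk_surjective h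

theorem cobd_one_const (a : Cochain 1 X) (x : X) :
    cobd 1 a (ContinuousMap.const _ x) = a (ContinuousMap.const _ x) := by
  have h : ∀ i : Fin 3, (ContinuousMap.const _ x : Sing 2 X).comp (simplexMap i.succAbove) =
      ContinuousMap.const _ x := fun _ => rfl
  rw [cobd_apply, Fin.sum_univ_three, h, h, h]
  simp

end Classes

/-! ### Angular cochains -/

section Angular

theorem CircleBundle.IsAngular.apply_const {X : Type} [TopologicalSpace X] [MulAction ℤˣ X]
    {E : CircleBundle X} {α : Cochain 1 (Borel E.Total)} {β : cocycles 2 (Borel X)}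
    (h : E.IsAngular α β) (s : EZ2) (ξ : E.Total) :
    (β : Cochain 2 (Borel X)) (ContinuousMap.const _ (borelMk X (s, E.proj ξ))) = 0 := by
  have h1 := congrFun (h.fibre_closed s ξ) (ContinuousMap.const _ 1)
  rw [cobd_pull, h.cobd_eq] at h1
  have h2 : (E.borelProj.comp ((E.fibre s ξ).comp (ContinuousMap.const _ 1)) : Sing 2 (Borel X)) =
      ContinuousMap.const _ (borelMk X (s, E.proj ξ)) := by
    ext p
    refine congrArg (borelMk X) (Prod.ext rfl ?_)
    exact E.proj_circle 1 ξ
  rw [← h2]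
  exact neg_eq_zero.1 h1

theorem standardLoop_vertex (i : Fin 2) : standardLoop (stdSimplex.vertex i) = 1 := by
  fin_cases i
  · change Circle.exp (2 * Real.pi * (stdSimplex.vertex (S := ℝ) (0 : Fin 2)) 1) = 1
    simp
  · change Circle.exp (2 * Real.pi * (stdSimplex.vertex (S := ℝ) (1 : Fin 2)) 1) = 1
    simp

theorem standardLoop_apply (p : stdSimplex ℝ (Fin 2)) :
    standardLoop p = Circle.exp (2 * Real.pi * p 1) := rfl

theorem continuous_stdSimplex_apply {n : ℕ} (i : Fin (n + 1)) :
    Continuous fun p : stdSimplex ℝ (Fin (n + 1)) => p i :=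
  (continuous_apply i).comp continuous_subtype_val

/-- A logarithmic cochain of `f` takes the value `1` on a loop along which `f` winds once. -/
theorem IsLogCochain.apply_loop {Y : Type} [TopologicalSpace Y] {f : C(Y, Circle)} {A : Y → ℝ}
    {M : Cochain 1 Y} (h : IsLogCochain f A M) (g : C(Circle, Y)) (v : Circle)
    (hg : ∀ u, f (g u) = u * v) : M (g.comp standardLoop) = 1 := by
  obtain ⟨x, hx⟩ := exists_circleExp_eq v
  have := h (g.comp standardLoop)
    ⟨fun p => p 1 + x, (continuous_stdSimplex_apply 1).add continuous_const⟩ (fun p => by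
      change Circle.exp (2 * Real.pi * (p 1 + x)) = f (g (standardLoop p))
      rw [hg, mul_add, Circle.exp_add, hx, standardLoop_apply])
  simp only [ContinuousMap.comp_apply, standardLoop_vertex, sub_self, sub_zero,
    ContinuousMap.coe_mk, stdSimplex.vertex_coe] at this
  simp at this
  exact_mod_cast this.symm

/-- A branch of `arg / 2π` on the circle. -/
def circleArg (u : Circle) : ℝ := (exists_circleExp_eq u).choose

theorem circleExp_circleArg (u : Circle) : Circle.exp (2 * Real.pi * circleArg u) = u :=
  (exists_circleExp_eq u).choose_spec

end Angular

/-! ### The trivial circle -/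

section TrivialCircle

/-- The tautological coordinate on `S¹_triv`. -/
def trivCoord : circleTriv.Total ≃ₜ Circle := Homeomorph.refl Circle

theorem triv_smul (g : ℤˣ) (η : circleTriv.Total) : g • η = η := by
  change (if g = 1 then η else id η) = η
  split_ifs <;> rfl

theorem trivCoord_smul (η : circleTriv.Total) :
    trivCoord ((-1 : ℤˣ) • η) = Circle.exp (2 * Real.pi * 0) * trivCoord η := by
  rw [mul_zero, Circle.exp_zero, one_mul, triv_smul]

/-- The projection of `Eℤ₂ ×_{ℤ₂} S¹_triv = ℝP^∞ × S¹` to the circle. -/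
def trivAngle : C(Borel circleTriv.Total, Circle) where
  toFun := Quotient.lift (fun y : EZ2 × circleTriv.Total => trivCoord y.2) (by
    rintro _ y ⟨g, rfl⟩
    exact congrArg trivCoord (triv_smul g y.2))
  continuous_toFun := Continuous.quotient_lift (by fun_prop) _

/-- The section `[s] ↦ [s, 1]` of `Eℤ₂ ×_{ℤ₂} S¹_triv → Eℤ₂ ×_{ℤ₂} pt`. -/
def trivSection : C(Borel Unit, Borel circleTriv.Total) :=
  borelMap (⟨fun _ => trivCoord.symm 1, continuous_const⟩ : C(Unit, circleTriv.Total))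
    (fun g _ => (triv_smul g _).symm)

theorem borelProj_comp_trivSection :
    circleTriv.borelProj.comp trivSection = ContinuousMap.id _ := by
  ext x
  obtain ⟨y, rfl⟩ := borelMk_surjective x
  rfl

theorem pull_trivSection_pull_borelProj {n : ℕ} (a : Cochain n (Borel Unit)) :
    pull n trivSection (pull n circleTriv.borelProj a) = a := by
  rw [pull_pull, borelProj_comp_trivSection]
  rfl

theorem isAngular_triv {α : Cochain 1 (Borel circleTriv.Total)} {A : Borel circleTriv.Total → ℝ}
    (h : IsLogCochain trivAngle A α) : circleTriv.IsAngular α 0 where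
  cobd_eq := by
    rw [h.cobd_eq_zero, ZeroMemClass.coe_zero, map_zero, neg_zero]
  fibre_closed s ξ := by rw [cobd_pull, h.cobd_eq_zero, map_zero]
  fibre_loop s ξ := h.apply_loop (circleTriv.fibre s ξ) (trivCoord ξ) fun _ => rfl

theorem exists_trivAngularCochain : ∃ α : Cochain 1 (Borel circleTriv.Total),
    IsLogCochain trivAngle (circleArg ∘ trivAngle) α :=
  exists_isLogCochain _ _ fun _ => circleExp_circleArg _

/-- A closed angular cochain for `S¹_triv`. -/
def trivAngularCochain : Cochain 1 (Borel circleTriv.Total) := exists_trivAngularCochain.choose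

theorem isLogCochain_trivAngularCochain :
    IsLogCochain trivAngle (circleArg ∘ trivAngle) trivAngularCochain :=
  exists_trivAngularCochain.choose_spec

theorem cobd_trivAngularCochain : cobd 1 trivAngularCochain = 0 :=
  isLogCochain_trivAngularCochain.cobd_eq_zero

theorem isChernClass_triv_iff (c : EqCoh Unit 2) : circleTriv.IsChernClass c ↔ c = 0 := by
  constructor
  · rintro ⟨α, β, h, rfl⟩
    refine cls_eq_zero_iff.2 ⟨-pull 1 trivSection α, ?_⟩
    rw [map_neg, cobd_pull, h.cobd_eq, map_neg, neg_neg, pull_trivSection_pull_borelProj]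
  · rintro rfl
    exact ⟨_, 0, isAngular_triv isLogCochain_trivAngularCochain, rfl⟩

/-- The universal cover for the trivial circle. -/
def trivCover : C(EZ2 × ℝ, Borel circleTriv.Total) := univCover trivCoord

/-- A closed `1`-cochain on `ℝP^∞ × S¹` that vanishes on the circles is exact. -/
theorem exists_cobd_eq_of_loop_eq_zero (δ : Cochain 1 (Borel circleTriv.Total))
    (hδ : cobd 1 δ = 0)
    (hl : ∀ s, pull 1 (circleTriv.fibre s (trivCoord.symm 1)) δ standardLoop = 0) :
    ∃ ε, cobd 0 ε = δ := by
  obtain ⟨θ, hθ⟩ := exists_cobd_eq (pull 1 trivCover δ) (by rw [cobd_pull, hδ, map_zero])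
  let R : ℤ → C(EZ2 × ℝ, EZ2 × ℝ) := fun k => ⟨fun y => (y.1, y.2 + k), by fun_prop⟩
  let T : C(EZ2 × ℝ, EZ2 × ℝ) :=
    ⟨fun y => (antipode y.1, y.2), (antipode_continuous.comp continuous_fst).prodMk continuous_snd⟩
  have hR : trivCover.comp (R 1) = trivCover := by
    refine ContinuousMap.ext fun y => congrArg (borelMk circleTriv.Total) (Prod.ext rfl ?_)
    refine congrArg trivCoord.symm ((circleExp_eq_iff _ _).2 ⟨1, rfl⟩)
  have hT : trivCover.comp T = trivCover :=
    ContinuousMap.ext fun y => (borelMk_eq_iff (X := circleTriv.Total) _ _).2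
      (Or.inr (Prod.ext rfl (triv_smul _ _).symm))
  obtain ⟨cR, hcR⟩ := exists_const_of_cobd_eq_zero (pull 0 (R 1) θ - θ) (by
    rw [map_sub, cobd_pull, hθ, pull_pull, hR, sub_self])
  obtain ⟨cT, hcT⟩ := exists_const_of_cobd_eq_zero (pull 0 T θ - θ) (by
    rw [map_sub, cobd_pull, hθ, pull_pull, hT, sub_self])
  have hT0 : ∀ σ, θ (T.comp σ) = θ σ := by
    intro σ
    have h1 := congrFun hcT σ
    have h2 := congrFun hcT (T.comp σ)
    have h3 : T.comp (T.comp σ) = σ :=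
      ContinuousMap.ext fun p => Prod.ext (antipode_involutive _) rfl
    simp only [Pi.sub_apply, pull_apply] at h1 h2
    rw [h3] at h2
    linarith
  have hR0 : ∀ σ, θ ((R 1).comp σ) = θ σ := by
    have hc : cR = 0 := by
      let s₀ : EZ2 := Classical.arbitrary _
      let ρ : Sing 1 (EZ2 × ℝ) :=
        ⟨fun p => (s₀, p 1), continuous_const.prodMk (continuous_stdSimplex_apply 1)⟩
      have h1 : cobd 0 θ ρ = 0 := by
        rw [hθ, ← hl s₀]
        refine congrArg δ (ContinuousMap.ext fun p => ?_)
        refine congrArg (borelMk circleTriv.Total) (Prod.ext rfl ?_)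
        exact (mul_one (Circle.exp (2 * Real.pi * p 1))).symm
      let σ₀ : Sing 0 (EZ2 × ℝ) := ContinuousMap.const _ (s₀, 0)
      have e0 : ρ.comp (simplexMap (Fin.succAbove 1)) = σ₀ := by
        ext1 p
        refine Prod.ext rfl ?_
        change (simplexMap (Fin.succAbove 1) p) 1 = 0
        rw [simplexMap_apply, Fin.sum_univ_one]
        simp
      have e1 : ρ.comp (simplexMap (Fin.succAbove 0)) = (R 1).comp σ₀ := by
        ext1 p
        refine Prod.ext rfl ?_
        change (simplexMap (Fin.succAbove 0) p) 1 = 0 + ((1 : ℤ) : ℝ)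
        rw [simplexMap_apply, Fin.sum_univ_one]
        simp
      rw [cobd_apply, Fin.sum_univ_two, e0, e1] at h1
      have h2 := congrFun hcR σ₀
      simp only [Pi.sub_apply, pull_apply] at h2
      simp at h1
      linarith
    intro σ
    have := congrFun hcR σ
    simp only [Pi.sub_apply, pull_apply] at this
    linarith
  have hRk : ∀ (k : ℤ) σ, θ ((R k).comp σ) = θ σ := by
    intro k
    induction k with
    | zero =>
      intro σ
      congr 1
      exact ContinuousMap.ext fun p => Prod.ext rfl (by simp [R])
    | succ k ih =>
      intro σ
      rw [← ih σ, ← hR0 ((R k).comp σ)]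
      congr 1
      exact ContinuousMap.ext fun p => Prod.ext rfl (by simp [R]; ring)
    | pred k ih =>
      intro σ
      rw [← ih σ, ← hR0 ((R (-(k : ℤ) - 1)).comp σ)]
      congr 1
      exact ContinuousMap.ext fun p => Prod.ext rfl (by simp [R]; ring)
  obtain ⟨ε, hε⟩ := exists_pull_eq (exists_lift_univCover trivCoord) θ fun σ σ' h => by
    obtain ⟨k, hk | hk⟩ := univCover_eq trivCoord trivCoord_smul h
    · rw [← hRk k σ']
      congr 1
      exact ContinuousMap.ext hk
    · rw [← hT0 σ', ← hRk k (T.comp σ')]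
      congr 1
      exact ContinuousMap.ext fun p => (hk p).trans (Prod.ext rfl (by simp [R, T]))
  have inj : Function.Injective (pull 1 trivCover) :=
    pull_injective (exists_lift_univCover trivCoord)
  refine ⟨ε, inj ?_⟩
  rw [← hθ, ← hε]
  rfl

end TrivialCircle

/-! ### The free circle -/

section FreeChernClass

/-- The `1`-cochain `(1 - χ) ∪ χ` on `Eℤ₂ × X`, for the indicator function `χ` of a fundamental
domain. Its coboundary is invariant and represents the generator of `H²(ℝP^∞; ℤ)`. -/
def sheetCochain (X : Type) [TopologicalSpace X] : Cochain 1 (EZ2 × X) := fun σ =>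
  (1 - sheet (σ (stdSimplex.vertex 0)).1) * sheet (σ (stdSimplex.vertex 1)).1

/-- The `0`-cochain `1 - χ`. -/
def cosheet (X : Type) [TopologicalSpace X] : Cochain 0 (EZ2 × X) :=
  ofFun fun y => 1 - sheet y.1

section General

variable (X : Type) [TopologicalSpace X] [MulAction ℤˣ X] [ContinuousConstSMul ℤˣ X]

theorem pull_deck_sheetCochain :
    pull 1 (deck X) (sheetCochain X) = sheetCochain X + cobd 0 (cosheet X) := by
  funext σ
  change (1 - sheet (antipode (σ (stdSimplex.vertex 0)).1)) *
    sheet (antipode (σ (stdSimplex.vertex 1)).1) = sheetCochain X σ + cobd 0 (cosheet X) σ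
  rw [cosheet, cobd_ofFun, sheetCochain, sheet_antipode, sheet_antipode]
  ring

theorem cosheet_add_pull_deck : cosheet X + pull 0 (deck X) (cosheet X) = fun _ => 1 := by
  funext σ
  change (1 - sheet (σ (stdSimplex.vertex 0)).1) +
    (1 - sheet (antipode (σ (stdSimplex.vertex 0)).1)) = 1
  rw [sheet_antipode]
  ring

end General

theorem exists_genCocycle : ∃ β : cocycles 2 (Borel Unit),
    pull 2 (borelMk Unit) β = cobd 1 (sheetCochain Unit) := by
  obtain ⟨β, hβ⟩ := exists_pull_borelMk_eq (cobd 1 (sheetCochain Unit)) (by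
    rw [← cobd_pull, pull_deck_sheetCochain, map_add, cobd_cobd, add_zero])
  refine ⟨⟨β, ?_⟩, hβ⟩
  change cobd 2 β = 0
  refine pull_borelMk_injective ?_
  rw [← cobd_pull, hβ, cobd_cobd, map_zero]

/-- A cocycle representing the generator of `H²(ℝP^∞; ℤ)`. -/
def genCocycle : cocycles 2 (Borel Unit) := exists_genCocycle.choose

theorem pull_genCocycle : pull 2 (borelMk Unit) genCocycle = cobd 1 (sheetCochain Unit) :=
  exists_genCocycle.choose_spec

theorem cobd_coe {n : ℕ} {X : Type} [TopologicalSpace X] (z : cocycles n X) :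
    cobd n (z : Cochain n X) = 0 := z.2

theorem hasIndex_genCocycle : HasIndex (X := Unit) genCocycle (-1) := by
  refine ⟨sheetCochain Unit, -cosheet Unit, pull_genCocycle.symm, ?_, ?_⟩
  · rw [pull_deck_sheetCochain, map_neg]
    abel
  · rw [map_neg, ← neg_add, cosheet_add_pull_deck]
    rfl

/-- An angular cochain for the free circle: on `Eℤ₂ × S¹` the increments of the logarithm, for
a branch that depends on the sheet, minus the sheet cochain. -/
theorem exists_isAngular_free :
    ∃ α : Cochain 1 (Borel circleFree.Total), circleFree.IsAngular α genCocycle := by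
  let f : C(EZ2 × circleFree.Total, Circle) := ⟨fun y => freeCoord y.2, by fun_prop⟩
  -- the branch of the logarithm is turned by a half period on one of the two sheets
  let A : EZ2 × circleFree.Total → ℝ := fun y =>
    if sheet y.1 = 1 then circleArg (-freeCoord y.2) - 1 / 2 else circleArg (freeCoord y.2)
  have hA : ∀ y, Circle.exp (2 * Real.pi * A y) = f y := by
    intro y
    by_cases h : sheet y.1 = 1
    · simp only [A, if_pos h]
      rw [mul_sub, Circle.exp_sub, circleExp_circleArg, ← neg_one_eq_circleExp]
      change -(freeCoord y.2) / -1 = freeCoord y.2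
      rw [div_neg, div_one, neg_neg]
    · simp only [A, if_neg h]
      exact circleExp_circleArg _
  obtain ⟨M, hM⟩ := exists_isLogCochain f A hA
  have hT : pull 1 (deck _) M = M + cobd 0 (cosheet _) := by
    have h1 := hM.change (f' := f.comp (deck _)) (A' := A ∘ deck _) (1 / 2)
      (fun y => -(1 - sheet y.1)) (fun y => freeCoord_smul y.2) (fun y => by
        have hs : sheet (deck circleFree.Total y).1 = 1 - sheet y.1 := sheet_antipode y.1
        have hc : freeCoord (deck circleFree.Total y).2 = -freeCoord y.2 := rfl
        rcases sheet_eq y.1 with h | h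
        · simp [A, hs, hc, h]
          ring
        · simp [A, hs, hc, h])
    rw [(hM.pull (deck _)).unique h1]
    have : ofFun (fun y : EZ2 × circleFree.Total => -(1 - sheet y.1)) = -cosheet _ := rfl
    rw [this, map_neg, sub_neg_eq_add]
  obtain ⟨α, hα⟩ := exists_pull_borelMk_eq (M - sheetCochain circleFree.Total) (by
    rw [map_sub, hT, pull_deck_sheetCochain, add_sub_add_right_eq_sub])
  have hd : cobd 1 α = -pull 2 circleFree.borelProj genCocycle := by
    refine pull_borelMk_injective ?_
    have h2 : pull 2 (borelMk circleFree.Total) (pull 2 circleFree.borelProj genCocycle) =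
        cobd 1 (sheetCochain circleFree.Total) :=
      congrArg (pull 2 (⟨fun y => (y.1, ()), by fun_prop⟩ :
        C(EZ2 × circleFree.Total, EZ2 × Unit))) pull_genCocycle
    rw [← cobd_pull, hα, map_sub, hM.cobd_eq_zero, zero_sub, map_neg, h2]
  have hc : ∀ s : EZ2, sheetCochain Unit (ContinuousMap.const _ (s, ())) = 0 := by
    intro s
    change (1 - sheet s) * sheet s = 0
    rcases sheet_eq s with h | h <;> rw [h] <;> rfl
  refine ⟨α, hd, fun s ξ => ?_, fun s ξ => ?_⟩
  · rw [cobd_pull, hd]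
    funext σ
    have h3 : pull 2 (borelMk Unit) genCocycle (ContinuousMap.const _ (s, ())) = 0 := by
      rw [pull_genCocycle, cobd_one_const, hc]
    exact neg_eq_zero.2 h3
  · let g : C(Circle, EZ2 × circleFree.Total) := ⟨fun u => (s, u • ξ), by fun_prop⟩
    have h1 : M (g.comp standardLoop) = 1 := hM.apply_loop g (freeCoord ξ) fun _ => rfl
    have h2 : sheetCochain circleFree.Total (g.comp standardLoop) = 0 := hc s
    have h3 := congrFun hα (g.comp standardLoop)
    rw [Pi.sub_apply, h1, h2, sub_zero] at h3
    exact h3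

/-- The first Chern class of the free circle has odd index: the index is compared with the period,
equal to `1`, of a primitive `θ` of the angular cochain along the square of the screw. -/
theorem odd_of_isAngular_free {α : Cochain 1 (Borel circleFree.Total)}
    {β : cocycles 2 (Borel Unit)} (h : circleFree.IsAngular α β) {N : ℤ}
    (hN : HasIndex (X := Unit) β N) : Odd N := by
  obtain ⟨a, b, h1, h2, h3⟩ := hN
  let g : C(EZ2 × ℝ, EZ2 × Unit) := ⟨fun y => (y.1, ()), by fun_prop⟩
  have hg : circleFree.borelProj.comp freeCover = (borelMk Unit).comp g := rfl
  have hgs : g.comp (screw : C(EZ2 × ℝ, EZ2 × ℝ)) = (deck Unit).comp g := rfl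
  obtain ⟨θ, hθ⟩ := exists_cobd_eq (pull 1 freeCover α + pull 1 g a) (by
    rw [map_add, cobd_pull, cobd_pull, h.cobd_eq, h1, map_neg, pull_pull, hg, pull_pull,
      neg_add_cancel])
  obtain ⟨c, hc⟩ := exists_const_of_cobd_eq_zero (θ - pull 0 screw θ - pull 0 g b) (by
    rw [map_sub, map_sub, cobd_pull, cobd_pull, hθ, h2, map_add, pull_pull, freeCover_comp_screw,
      pull_pull, hgs, map_sub, pull_pull]
    abel)
  -- `ρ` lifts a fibre and runs from `σ₀` to its translate under the square of the screw, so that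
  -- the increment of `θ` along it is `1`; applying `hc` at `σ₀` and at its translate gives the sum
  -- `-1 - N = 2 c`
  let s₀ : EZ2 := Classical.arbitrary _
  let ρ : Sing 1 (EZ2 × ℝ) :=
    ⟨fun p => (s₀, p 1), continuous_const.prodMk (continuous_stdSimplex_apply 1)⟩
  let σ₀ : Sing 0 (EZ2 × ℝ) := ContinuousMap.const _ (s₀, 0)
  have hρ : cobd 0 θ ρ = 1 := by
    rw [hθ, Pi.add_apply]
    have e1 : pull 1 freeCover α ρ = 1 := by
      rw [← h.fibre_loop s₀ (freeCoord.symm 1)]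
      refine congrArg α (ContinuousMap.ext fun p => ?_)
      refine congrArg (borelMk circleFree.Total) (Prod.ext rfl ?_)
      exact (mul_one (Circle.exp (2 * Real.pi * p 1))).symm
    have e2 : pull 1 g a ρ = 0 := by
      change a (ContinuousMap.const _ (s₀, ())) = 0
      rw [← cobd_one_const a, h1]
      exact h.apply_const s₀ (freeCoord.symm 1)
    rw [e1, e2, add_zero]
  have e0 : ρ.comp (simplexMap (Fin.succAbove 1)) = σ₀ := by
    ext1 p
    refine Prod.ext rfl ?_
    change (simplexMap (Fin.succAbove 1) p) 1 = 0
    rw [simplexMap_apply, Fin.sum_univ_one]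
    simp
  have e1 : ρ.comp (simplexMap (Fin.succAbove 0)) =
      (screw : C(EZ2 × ℝ, EZ2 × ℝ)).comp ((screw : C(EZ2 × ℝ, EZ2 × ℝ)).comp σ₀) := by
    ext1 p
    refine Prod.ext (antipode_involutive s₀).symm ?_
    change (simplexMap (Fin.succAbove 0) p) 1 = (0 : ℝ) + 1 / 2 + 1 / 2
    rw [simplexMap_apply, Fin.sum_univ_one]
    norm_num
    exact stdSimplex.eq_one_of_unique (X := Fin 1) p 0
  rw [cobd_apply, Fin.sum_univ_two, e0, e1] at hρ
  have k1 := congrFun hc σ₀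
  have k2 := congrFun hc ((screw : C(EZ2 × ℝ, EZ2 × ℝ)).comp σ₀)
  have k3 := congrFun h3 (g.comp σ₀)
  have k4 : b (g.comp ((screw : C(EZ2 × ℝ, EZ2 × ℝ)).comp σ₀)) =
    b ((deck Unit).comp (g.comp σ₀)) := rfl
  simp only [Pi.sub_apply, Pi.add_apply, pull_apply] at k1 k2 k3
  rw [k4] at k2
  simp at hρ
  refine ⟨-c - 1, ?_⟩
  linarith

end FreeChernClass

/-! ### The class of the cocycle `τ` -/

section Tau

theorem coe_zero_cocycles {n : ℕ} {X : Type} [TopologicalSpace X] :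
    ((0 : cocycles n X) : Cochain n X) = 0 := rfl

/-- The cocycle `π^* c ∪ α` on `ℝP^∞ × S¹`, for the generator `c` of `H²(ℝP^∞; ℤ)` and the closed
angular cochain `α`. -/
def tauRep : cocycles 3 (Borel circleTriv.Total) :=
  ⟨cup (pull 2 circleTriv.borelProj genCocycle) trivAngularCochain, by
    change cobd 3 (cup (pull 2 circleTriv.borelProj genCocycle) trivAngularCochain :
      Cochain 3 (Borel circleTriv.Total)) = 0
    rw [cobd_cup_two_one, cobd_pull, cobd_coe, map_zero, zero_cup, cobd_trivAngularCochain,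
      cup_zero, add_zero]⟩

/-- The class `τ_{S¹}`. -/
def tauClass : EqCoh circleTriv.Total 3 := cls tauRep

theorem isPushforward_tauClass :
    circleTriv.IsPushforward tauClass (cls genCocycle : EqCoh Unit 2) := by
  refine ⟨trivAngularCochain, 0, 0, genCocycle, tauRep,
    isAngular_triv isLogCochain_trivAngularCochain, rfl, rfl, ?_⟩
  rw [map_zero, zero_add]
  rfl

theorem isPushforward_zero {E : CircleBundle Unit} {α : Cochain 1 (Borel E.Total)}
    {β : cocycles 2 (Borel Unit)} (h : E.IsAngular α β) :
    E.IsPushforward (0 : EqCoh E.Total 3) (0 : EqCoh Unit 2) := by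
  refine ⟨α, β, 0, 0, 0, h, rfl, rfl, ?_⟩
  rw [map_zero, zero_add, coe_zero_cocycles, coe_zero_cocycles, map_zero]
  exact (zero_cup α).symm

theorem translate_one {X : Type} [TopologicalSpace X] [MulAction ℤˣ X] [ContinuousConstSMul ℤˣ X]
    {n : ℕ} (a : Cochain n X) : translate 1 a = a := by
  funext σ
  refine congrArg a (ContinuousMap.ext fun p => ?_)
  change (1 : ℤˣ)⁻¹ • σ p = σ p
  rw [inv_one, one_smul]

theorem translate_neg_one {X : Type} [TopologicalSpace X] [MulAction ℤˣ X]
    [ContinuousConstSMul ℤˣ X] {n : ℕ} (a : Cochain n (EZ2 × X)) :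
    translate (-1) a = pull n (deck X) a := by
  funext σ
  refine congrArg a (ContinuousMap.ext fun p => ?_)
  change (-1 : ℤˣ)⁻¹ • σ p = (-1 : ℤˣ) • σ p
  rw [Int.units_inv_eq_self]

/-- The angular coordinate on `Eℤ₂ × S¹_triv`. -/
def tautAngle : C(EZ2 × circleTriv.Total, Circle) := trivAngle.comp (borelMk circleTriv.Total)

theorem tauCocycle_apply (g k : ℤˣ) (y : EZ2 × circleTriv.Total) :
    tauCocycle.toFun g k y.2 = if g = -1 ∧ k = -1 then tautAngle y else 1 := by
  change (if g = -1 ∧ k = -1 then ContinuousMap.id Circle else ContinuousMap.const Circle 1) _ = _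
  split_ifs <;> rfl

theorem tauCocycle_represents_tauClass : tauCocycle.Represents tauClass := by
  let M := pull 1 (borelMk circleTriv.Total) trivAngularCochain
  have hM : IsLogCochain tautAngle (circleArg ∘ tautAngle) M :=
    isLogCochain_trivAngularCochain.pull (borelMk circleTriv.Total)
  have hMT : pull 1 (deck _) M = M := pull_deck_pull_borelMk _
  have hMd : cobd 1 M = 0 := hM.cobd_eq_zero
  let B : Cochain 1 (EZ2 × circleTriv.Total) := cup (cosheet circleTriv.Total) M
  have hBT : pull 1 (deck _) B = cup (pull 0 (deck _) (cosheet circleTriv.Total)) M := by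
    conv_rhs => rw [← hMT]
    rfl
  have hB : pull 1 (deck _) B + B = M := by
    rw [hBT, ← add_cup, add_comm, cosheet_add_pull_deck, const_cup_one, one_smul]
  let a : Cochain 2 (EZ2 × circleTriv.Total) := cup (sheetCochain circleTriv.Total) M
  have haT : pull 2 (deck _) a = cup (pull 1 (deck _) (sheetCochain circleTriv.Total)) M := by
    conv_rhs => rw [← hMT]
    rfl
  have h1 : ¬ ((1 : ℤˣ) = -1) := by decide
  refine ⟨fun g k y => if g = -1 ∧ k = -1 then circleArg (tautAngle y) else 0,
    fun g => if g = -1 then B else 0, a, tauRep, ?_, ?_, ?_, ?_, ?_, rfl⟩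
  · intro g k y
    rw [tauCocycle_apply]
    beta_reduce
    split_ifs
    · exact circleExp_circleArg _
    · rw [mul_zero, Circle.exp_zero]
  · intro g h k y
    have hy : tautAngle (g⁻¹ • y) = tautAngle y := congrArg trivCoord (triv_smul g⁻¹ y.2)
    beta_reduce
    rw [hy]
    rcases Int.units_eq_one_or g with rfl | rfl <;>
      rcases Int.units_eq_one_or h with rfl | rfl <;>
        rcases Int.units_eq_one_or k with rfl | rfl <;> simp [h1]
  · intro g k σ r hr
    simp only [tauCocycle_apply] at hr
    by_cases hgk : g = -1 ∧ k = -1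
    · obtain ⟨rfl, rfl⟩ := hgk
      simp only [and_self, if_true, neg_mul_neg, mul_one, h1, if_false, sub_zero] at hr ⊢
      rw [translate_neg_one, hB]
      exact hM σ r hr
    · simp only [hgk, if_false] at hr ⊢
      obtain ⟨m, hm⟩ := log_unique r (ContinuousMap.const _ 0) fun p => by
        rw [hr p]
        simp
      rw [hm, hm]
      have : (translate g (if k = -1 then B else 0) - (if g * k = -1 then B else 0) +
          if g = -1 then B else 0) = 0 := by
        rcases Int.units_eq_one_or g with rfl | rfl <;>
          rcases Int.units_eq_one_or k with rfl | rfl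
        · simp [h1, translate_one]
        · simp [h1, translate_one]
        · simp only [mul_one, if_true, h1, if_false, translate_neg_one, map_zero]
          abel
        · exact absurd ⟨rfl, rfl⟩ hgk
      rw [this]
      simp
  · intro g
    rcases Int.units_eq_one_or g with rfl | rfl
    · simp [h1, translate_one]
    · beta_reduce
      rw [translate_neg_one, haT, pull_deck_sheetCochain, if_pos rfl, cobd_cup_zero_one, hMd,
        cup_zero, add_zero, add_cup]
      exact add_sub_cancel_left _ _
  · have hd : cobd 1 (sheetCochain circleTriv.Total) =
        pull 2 (borelMk circleTriv.Total) (pull 2 circleTriv.borelProj genCocycle) :=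
      (congrArg (pull 2 (⟨fun y => (y.1, ()), by fun_prop⟩ :
        C(EZ2 × circleTriv.Total, EZ2 × Unit))) pull_genCocycle).symm
    rw [cobd_cup_one_one, hMd, cup_zero, sub_zero, hd]
    rfl

/-- The data representing the class of `τ`, reduced to a single invariant logarithm `l` of the
angular coordinate. -/
theorem exists_of_represents {h : EqCoh circleTriv.Total 3} (hh : tauCocycle.Represents h) :
    ∃ (l : EZ2 × circleTriv.Total → ℝ) (B : Cochain 1 (EZ2 × circleTriv.Total))
      (a : Cochain 2 (EZ2 × circleTriv.Total)) (z : cocycles 3 (Borel circleTriv.Total)),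
      (∀ y, Circle.exp (2 * Real.pi * l y) = tautAngle y) ∧ (∀ y, l (deck _ y) = l y) ∧
      IsLogCochain tautAngle l (pull 1 (deck _) B + B) ∧
      pull 2 (deck _) a - a = cobd 1 B ∧
      pull 3 (borelMk circleTriv.Total) z = cobd 2 a ∧ cls z = h := by
  obtain ⟨l, b, a, z, h1, h2, h3, h4, h5, h6⟩ := hh
  have hne : ¬ ((1 : ℤˣ) = -1) := by decide
  have hexp : ∀ y, Circle.exp (2 * Real.pi * l 1 1 y) = 1 := by
    intro y
    rw [h1, tauCocycle_apply]
    simp [hne]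
  have hb1 : ∀ σ, ((b 1 σ : ℤ) : ℝ) =
      -(l 1 1 (σ (stdSimplex.vertex 1)) - l 1 1 (σ (stdSimplex.vertex 0))) := by
    intro σ
    have := h3 1 1 σ (ContinuousMap.const _ 0) (by
      intro p
      rw [tauCocycle_apply]
      simp [hne])
    rw [translate_one, mul_one, sub_self, zero_add] at this
    rw [← this]
    simp
  refine ⟨fun y => l (-1) (-1) y + l 1 1 y, b (-1), a, z, ?_, ?_, ?_, ?_, h5, h6⟩
  · intro y
    rw [mul_add, Circle.exp_add, hexp, mul_one, h1, tauCocycle_apply]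
    simp
  · intro y
    have e1 := h2 (-1) (-1) (-1) y
    have e2 := h2 1 1 (-1) y
    have e3 := h2 (-1) 1 1 y
    rw [Int.units_inv_eq_self] at e1 e3
    simp only [neg_mul_neg, mul_one, inv_one, one_smul, one_mul] at e1 e2 e3
    change l (-1) (-1) ((-1 : ℤˣ) • y) + l 1 1 ((-1 : ℤˣ) • y) = _
    linarith
  · intro σ r hr
    have := h3 (-1) (-1) σ r (by
      intro p
      rw [hr, tauCocycle_apply]
      simp)
    rw [translate_neg_one, neg_mul_neg, mul_one] at this
    simp only [Pi.add_apply, Pi.sub_apply, Int.cast_add, Int.cast_sub, hb1] at this ⊢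
    linarith
  · rw [← translate_neg_one]
    exact h4 (-1)

theorem tauCocycle_represents_unique {h h' : EqCoh circleTriv.Total 3}
    (hh : tauCocycle.Represents h) (hh' : tauCocycle.Represents h') : h = h' := by
  obtain ⟨l, B, a, z, h1, h2, h3, h4, h5, rfl⟩ := exists_of_represents hh
  obtain ⟨l', B', a', z', h1', h2', h3', h4', h5', rfl⟩ := exists_of_represents hh'
  choose n hn using fun y => (circleExp_eq_iff (l' y) (l y)).1 ((h1' y).trans (h1 y).symm)
  have hnT : ∀ y, n (deck _ y) = n y := by
    intro y
    have e1 := hn (deck _ y)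
    rw [h2, h2', hn y] at e1
    exact_mod_cast (add_left_cancel e1).symm
  have hM : pull 1 (deck _) B' + B' = pull 1 (deck _) B + B - cobd 0 (ofFun n) := by
    refine h3'.unique (h3.change 0 n (fun y => ?_) fun y => ?_)
    · rw [mul_zero, Circle.exp_zero, one_mul]
    · rw [hn, add_zero]
  obtain ⟨e, he⟩ := exists_add_pull_deck (ofFun n) (funext fun σ => hnT _)
  obtain ⟨f, hf⟩ := exists_sub_pull_deck (B - B' - cobd 0 e) (by
    rw [← he, map_add, cobd_pull] at hM
    rw [map_sub, map_sub]
    linear_combination (exp := 1) -hM)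
  obtain ⟨v, hv⟩ := exists_pull_borelMk_eq ((a - a') + cobd 1 f) (by
    have : cobd 1 f - pull 2 (deck _) (cobd 1 f) = cobd 1 B - cobd 1 B' := by
      rw [← cobd_pull, ← map_sub, hf, map_sub, map_sub, cobd_cobd, sub_zero]
    rw [← h4, ← h4'] at this
    rw [map_add, map_sub]
    linear_combination (exp := 1) -this)
  refine cls_eq_cls_iff.2 ⟨v, pull_borelMk_injective ?_⟩
  rw [← cobd_pull, hv, map_add, map_sub, cobd_cobd, add_zero, map_sub, h5, h5']

theorem tauCocycle_represents_iff (h : EqCoh circleTriv.Total 3) :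
    tauCocycle.Represents h ↔ h = tauClass :=
  ⟨fun hh => tauCocycle_represents_unique hh tauCocycle_represents_tauClass,
    fun hh => hh ▸ tauCocycle_represents_tauClass⟩

end Tau

/-! ### Integration along the fibre -/

section Pushforward

theorem exists_cobd_eq_pull_borelProj {y : Cochain 3 (Borel Unit)}
    (hy : cobd 3 (pull 3 circleTriv.borelProj y) = 0) :
    ∃ x, cobd 2 x = pull 3 circleTriv.borelProj y := by
  have h1 := congrArg (pull 4 trivSection) hy
  rw [cobd_pull, pull_trivSection_pull_borelProj, map_zero] at h1
  obtain ⟨x, hx⟩ := exists_cobd_eq_three y h1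
  exact ⟨pull 2 circleTriv.borelProj x, by rw [cobd_pull, hx]⟩

/-- Integration along the fibre has trivial kernel on `H³_{ℤ₂}(S¹_triv)`, since `H³(ℝP^∞) = 0`. -/
theorem eq_zero_of_isPushforward_zero {h : EqCoh circleTriv.Total 3}
    (hh : circleTriv.IsPushforward h (0 : EqCoh Unit 2)) : h = 0 := by
  obtain ⟨α, β, y, w, z, hα, hw, rfl, hz⟩ := hh
  obtain ⟨v, hv⟩ := cls_eq_zero_iff.1 hw
  let P := circleTriv.borelProj
  have key : cobd 2 (cup (pull 1 P v) α : Cochain 2 _) =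
      cup (pull 2 P w) α + pull 3 P (cup v (β : Cochain 2 (Borel Unit)) : Cochain 3 _) := by
    rw [cobd_cup_one_one, hα.cobd_eq, cobd_pull, hv, cup_neg, sub_neg_eq_add]
    rfl
  have hz' : (z : Cochain 3 (Borel circleTriv.Total)) =
      cobd 2 (cup (pull 1 P v) α : Cochain 2 _) +
        pull 3 P (y - (cup v (β : Cochain 2 (Borel Unit)) : Cochain 3 _)) := by
    rw [hz, key, map_sub]
    change pull 3 P y + (cup (pull 2 P w) α : Cochain 3 _) = _
    abel
  obtain ⟨x, hx⟩ := exists_cobd_eq_pull_borelProj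
    (y := y - (cup v (β : Cochain 2 (Borel Unit)) : Cochain 3 _)) (by
      have := cobd_coe z
      rwa [hz', map_add, cobd_cobd, zero_add] at this)
  refine cls_eq_zero_iff.2 ⟨(cup (pull 1 P v) α : Cochain 2 _) + x, ?_⟩
  rw [hz', map_add, hx]

/-- Any two angular cochains on `ℝP^∞ × S¹` differ by a cochain pulled back from `ℝP^∞` and a
coboundary. -/
theorem exists_eq_trivAngularCochain_add {α : Cochain 1 (Borel circleTriv.Total)}
    {β : cocycles 2 (Borel Unit)} (hα : circleTriv.IsAngular α β) :
    ∃ (κ : Cochain 1 (Borel Unit)) (ε : Cochain 0 (Borel circleTriv.Total)),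
      α = trivAngularCochain + pull 1 circleTriv.borelProj κ + cobd 0 ε := by
  let κ := pull 1 trivSection (α - trivAngularCochain)
  have hτ := isAngular_triv isLogCochain_trivAngularCochain
  have hd : cobd 1 (α - trivAngularCochain) = -pull 2 circleTriv.borelProj β := by
    rw [map_sub, hα.cobd_eq, cobd_trivAngularCochain, sub_zero]
  obtain ⟨ε, hε⟩ := exists_cobd_eq_of_loop_eq_zero
    (α - trivAngularCochain - pull 1 circleTriv.borelProj κ) (by
      rw [map_sub, hd, cobd_pull, cobd_pull, hd, map_neg, pull_trivSection_pull_borelProj, map_neg,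
        sub_neg_eq_add, neg_add_cancel]) (fun s => by
      have e1 : pull 1 (circleTriv.fibre s (trivCoord.symm 1)) (pull 1 circleTriv.borelProj κ)
          standardLoop = 0 := by
        change (α - trivAngularCochain) (ContinuousMap.const _
          (borelMk circleTriv.Total (s, trivCoord.symm 1))) = 0
        rw [← cobd_one_const (α - trivAngularCochain), hd]
        exact neg_eq_zero.2 (hα.apply_const s (trivCoord.symm 1))
      rw [map_sub, map_sub, Pi.sub_apply, Pi.sub_apply, hα.fibre_loop, hτ.fibre_loop, e1]
      rfl)
  exact ⟨κ, ε, by rw [hε]; abel⟩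

theorem HasIndex.add_cobd {X : Type} [TopologicalSpace X] [MulAction ℤˣ X]
    [ContinuousConstSMul ℤˣ X] {w : Cochain 2 (Borel X)} {N : ℤ} (h : HasIndex w N)
    (v : Cochain 1 (Borel X)) : HasIndex (w + cobd 1 v) N := by
  obtain ⟨a, b, h1, h2, h3⟩ := h
  refine ⟨a + pull 1 (borelMk X) v, b, by rw [map_add, h1, cobd_pull, map_add], ?_, h3⟩
  rw [map_add, pull_deck_pull_borelMk, h2, add_sub_add_right_eq_sub]

theorem exists_odd_hasIndex {c : EqCoh Unit 2} (hc : circleFree.IsChernClass c)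
    {w : cocycles 2 (Borel Unit)} (hw : cls w = c) : ∃ N, HasIndex (X := Unit) w N ∧ Odd N := by
  obtain ⟨α, β, hα, rfl⟩ := hc
  obtain ⟨N, hN⟩ := exists_hasIndex (X := Unit) β (cobd_coe β)
  obtain ⟨v, hv⟩ := cls_eq_cls_iff.1 hw
  refine ⟨N, ?_, odd_of_isAngular_free hα hN⟩
  have := hN.add_cobd v
  rwa [hv, add_sub_cancel] at this

theorem isChernClass_free_iff (c : EqCoh Unit 2) :
    circleFree.IsChernClass c ↔ c = cls genCocycle := by
  constructor
  · intro hc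
    obtain ⟨w, rfl⟩ := cls_surjective c
    obtain ⟨N, hN, hodd⟩ := exists_odd_hasIndex hc rfl
    exact cls_eq_cls_iff.2 ((hN.sub hasIndex_genCocycle).exists_cobd_eq
      (hodd.sub_odd (by decide)))
  · rintro rfl
    obtain ⟨α, hα⟩ := exists_isAngular_free
    exact ⟨α, genCocycle, hα, rfl⟩

theorem eq_tauClass_of_isPushforward {h : EqCoh circleTriv.Total 3}
    (hh : circleTriv.IsPushforward h (cls genCocycle : EqCoh Unit 2)) : h = tauClass := by
  obtain ⟨α, β, y, w, z, hα, hw, rfl, hz⟩ := hh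
  obtain ⟨v, hv⟩ := cls_eq_cls_iff.1 hw
  obtain ⟨κ, ε, rfl⟩ := exists_eq_trivAngularCochain_add hα
  let P := circleTriv.borelProj
  have hwd : cobd 2 (pull 2 P w) = 0 := by rw [cobd_pull, cobd_coe, map_zero]
  have key1 : cobd 2 (cup (pull 2 P w) ε : Cochain 2 _) = cup (pull 2 P w) (cobd 0 ε) := by
    rw [cobd_cup_two_zero, hwd, zero_cup, zero_add]
  have key2 : cobd 2 (cup (pull 1 P v) trivAngularCochain : Cochain 2 _) =
      cup (pull 2 P w) trivAngularCochain - (tauRep : Cochain 3 _) := by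
    rw [cobd_cup_one_one, cobd_trivAngularCochain, cup_zero, sub_zero, cobd_pull, hv, map_sub,
      sub_cup]
    rfl
  have hz' : (z : Cochain 3 (Borel circleTriv.Total)) - (tauRep : Cochain 3 _) =
      cobd 2 ((cup (pull 2 P w) ε : Cochain 2 _) + cup (pull 1 P v) trivAngularCochain) +
        pull 3 P (y + (cup (w : Cochain 2 (Borel Unit)) κ : Cochain 3 _)) := by
    rw [hz, map_add, key1, key2, cup_add, cup_add, map_add]
    change pull 3 P y + ((cup (pull 2 P w) trivAngularCochain : Cochain 3 _) +
      pull 3 P (cup (w : Cochain 2 (Borel Unit)) κ : Cochain 3 _) +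
        (cup (pull 2 P w) (cobd 0 ε) : Cochain 3 _)) - _ = _
    abel
  obtain ⟨x, hx⟩ := exists_cobd_eq_pull_borelProj
    (y := y + (cup (w : Cochain 2 (Borel Unit)) κ : Cochain 3 _)) (by
      have : cobd 3 ((z : Cochain 3 (Borel circleTriv.Total)) - (tauRep : Cochain 3 _)) = 0 := by
        rw [map_sub, cobd_coe, cobd_coe, sub_zero]
      rwa [hz', map_add, cobd_cobd, zero_add] at this)
  refine cls_eq_cls_iff.2
    ⟨(cup (pull 2 P w) ε : Cochain 2 _) + cup (pull 1 P v) trivAngularCochain + x, ?_⟩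
  rw [hz', map_add (cobd 2), hx]

theorem eqCoh_free_eq_zero (h : EqCoh circleFree.Total 3) : h = 0 := by
  obtain ⟨z, rfl⟩ := cls_surjective h
  exact cls_eq_zero_iff.2 (exists_cobd_eq_free (n := 1) _ (cobd_coe z))

/-- The free circle is not T-dual to itself: the Gysin sequence would give a relation in degree `4`
between two classes of odd index. -/
theorem not_isPushforward_free {h : EqCoh circleFree.Total 3} {c : EqCoh Unit 2}
    (hc : circleFree.IsChernClass c) : ¬ circleFree.IsPushforward h c := by
  rintro ⟨α, β, y, w, z, hα, hw, rfl, hz⟩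
  obtain ⟨N, hN, hodd⟩ := exists_odd_hasIndex hc hw
  obtain ⟨N', hN'⟩ := exists_hasIndex (X := Unit) β (cobd_coe β)
  have hodd' := odd_of_isAngular_free hα hN'
  let P := circleFree.borelProj
  have hwd : cobd 2 (pull 2 P w) = 0 := by rw [cobd_pull, cobd_coe, map_zero]
  have h1 : pull 4 P (cobd 3 y - (cup (w : Cochain 2 (Borel Unit)) (β : Cochain 2 (Borel Unit)) :
      Cochain 4 _)) = 0 := by
    have h2 := cobd_coe z
    rw [hz, map_add] at h2
    have h3 : cobd 3 (cup (pull 2 P w) α : Cochain 3 _) =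
        -pull 4 P (cup (w : Cochain 2 (Borel Unit)) (β : Cochain 2 (Borel Unit)) :
          Cochain 4 _) := by
      rw [cobd_cup_two_one, hwd, zero_cup, zero_add, hα.cobd_eq, cup_neg]
      rfl
    rw [map_sub, sub_eq_add_neg, ← h3]
    exact h2
  have h4 : cobd 3 y = (cup (w : Cochain 2 (Borel Unit)) (β : Cochain 2 (Borel Unit)) :
      Cochain 4 _) := by
    refine sub_eq_zero.1 (pull_borelMk_injective ?_)
    have h5 := congrArg (pull 4 ((borelMk circleFree.Total).comp
      ⟨fun y : EZ2 × Unit => (y.1, freeCoord.symm 1), by fun_prop⟩)) h1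
    rw [map_zero] at h5
    rw [map_zero]
    exact h5
  exact Int.not_even_iff_odd.2 (hodd.mul hodd') (hN.even_mul hN' (cobd_coe β) h4)

end Pushforward

/-! ### Invariance of T-duality under isomorphism -/

section Transport

theorem pullCoh_pullCoh {X Y Z : Type} [TopologicalSpace X] [TopologicalSpace Y]
    [TopologicalSpace Z] (n : ℕ) (f : C(X, Y)) (g : C(Y, Z)) (h : Coh n Z) :
    pullCoh n f (pullCoh n g h) = pullCoh n (g.comp f) h := by
  obtain ⟨z, rfl⟩ := cls_surjective h
  rfl

theorem pullCoh_id {X : Type} [TopologicalSpace X] (n : ℕ) (h : Coh n X) :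
    pullCoh n (ContinuousMap.id X) h = h := by
  obtain ⟨z, rfl⟩ := cls_surjective h
  rfl

variable {X : Type} [TopologicalSpace X] [MulAction ℤˣ X]

namespace CircleBundle

variable {E F : CircleBundle X}

/-- The homeomorphism of Borel constructions induced by an isomorphism, as a continuous map. -/
def Iso.borel (φ : Iso E F) : C(Borel E.Total, Borel F.Total) :=
  borelMap (φ.toHomeomorph : C(E.Total, F.Total)) φ.map_z2

/-- The inverse isomorphism. -/
def Iso.symm (φ : Iso E F) : Iso F E where
  toHomeomorph := φ.toHomeomorph.symm
  map_proj ξ := by rw [← φ.map_proj, φ.toHomeomorph.apply_symm_apply]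
  map_z2 g ξ := φ.toHomeomorph.injective (by
    rw [φ.map_z2, φ.toHomeomorph.apply_symm_apply, φ.toHomeomorph.apply_symm_apply])
  map_circle u ξ := φ.toHomeomorph.injective (by
    rw [φ.map_circle, φ.toHomeomorph.apply_symm_apply, φ.toHomeomorph.apply_symm_apply])

theorem Iso.borel_comp_borel_symm (φ : Iso E F) :
    φ.borel.comp φ.symm.borel = ContinuousMap.id _ := by
  ext x
  obtain ⟨y, rfl⟩ := borelMk_surjective x
  exact congrArg (borelMk F.Total) (Prod.ext rfl (φ.toHomeomorph.apply_symm_apply y.2))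

theorem Iso.borelProj_comp_borel (φ : Iso E F) : F.borelProj.comp φ.borel = E.borelProj := by
  ext x
  obtain ⟨y, rfl⟩ := borelMk_surjective x
  exact congrArg (borelMk X) (Prod.ext rfl (φ.map_proj y.2))

theorem Iso.borel_comp_fibre (φ : Iso E F) (s : EZ2) (ξ : E.Total) :
    φ.borel.comp (E.fibre s ξ) = F.fibre s (φ.toHomeomorph ξ) :=
  ContinuousMap.ext fun u => congrArg (borelMk F.Total) (Prod.ext rfl (φ.map_circle u ξ))

theorem IsAngular.pull_iso (φ : Iso E F) {α : Cochain 1 (Borel F.Total)} {β : cocycles 2 (Borel X)}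
    (h : F.IsAngular α β) : E.IsAngular (pull 1 φ.borel α) β where
  cobd_eq := by rw [cobd_pull, h.cobd_eq, map_neg, pull_pull, φ.borelProj_comp_borel]
  fibre_closed s ξ := by rw [pull_pull, φ.borel_comp_fibre, h.fibre_closed]
  fibre_loop s ξ := by rw [pull_pull, φ.borel_comp_fibre, h.fibre_loop]

theorem IsChernClass.of_iso (φ : Iso E F) {c : EqCoh X 2} (h : F.IsChernClass c) :
    E.IsChernClass c := by
  obtain ⟨α, β, hα, hβ⟩ := h
  exact ⟨_, β, hα.pull_iso φ, hβ⟩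

theorem IsPushforward.of_iso (φ : Iso E F) {n : ℕ} {h : EqCoh F.Total (n + 1)} {c : EqCoh X n}
    (hh : F.IsPushforward h c) : E.IsPushforward (pullCoh (n + 1) φ.borel h) c := by
  obtain ⟨α, β, y, w, z, hα, hw, rfl, hz⟩ := hh
  refine ⟨_, β, y, w, pullCocycles (n + 1) φ.borel z, hα.pull_iso φ, hw, rfl, ?_⟩
  rw [coe_pullCocycles, hz, map_add, pull_pull, φ.borelProj_comp_borel, pull_cup, pull_pull,
    φ.borelProj_comp_borel]

/-- The map of fibre products induced by a pair of isomorphisms, on Borel constructions. -/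
def borelFibreProductMap {E' F' : CircleBundle X} (φ : Iso E E') (ψ : Iso F F') :
    C(Borel (FibreProduct E F), Borel (FibreProduct E' F')) :=
  borelMap
    ⟨fun p => ⟨(φ.toHomeomorph p.1.1, ψ.toHomeomorph p.1.2), by
      rw [φ.map_proj, ψ.map_proj, p.2]⟩, by
      refine Continuous.subtype_mk ?_ _
      exact (φ.toHomeomorph.continuous.comp (continuous_fst.comp continuous_subtype_val)).prodMk
        (ψ.toHomeomorph.continuous.comp (continuous_snd.comp continuous_subtype_val))⟩
    (fun g p => Subtype.ext (Prod.ext (φ.map_z2 g p.1.1) (ψ.map_z2 g p.1.2)))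

theorem borelFst_comp_borelFibreProductMap {E' F' : CircleBundle X} (φ : Iso E E')
    (ψ : Iso F F') :
    (borelFst E' F').comp (borelFibreProductMap φ ψ) = φ.borel.comp (borelFst E F) := by
  ext x
  obtain ⟨y, rfl⟩ := borelMk_surjective x
  rfl

theorem borelSnd_comp_borelFibreProductMap {E' F' : CircleBundle X} (φ : Iso E E')
    (ψ : Iso F F') :
    (borelSnd E' F').comp (borelFibreProductMap φ ψ) = ψ.borel.comp (borelSnd E F) := by
  ext x
  obtain ⟨y, rfl⟩ := borelMk_surjective x
  rfl

/-- The exchange of factors of a fibre product, on Borel constructions. -/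
def borelSwap (E F : CircleBundle X) : C(Borel (FibreProduct E F), Borel (FibreProduct F E)) :=
  borelMap
    ⟨fun p => ⟨(p.1.2, p.1.1), p.2.symm⟩, by
      refine Continuous.subtype_mk ?_ _
      exact (continuous_snd.comp continuous_subtype_val).prodMk
        (continuous_fst.comp continuous_subtype_val)⟩
    (fun _ _ => rfl)

theorem borelFst_comp_borelSwap (E F : CircleBundle X) :
    (borelFst F E).comp (borelSwap E F) = borelSnd E F := by
  ext x
  obtain ⟨y, rfl⟩ := borelMk_surjective x
  rfl

theorem borelSnd_comp_borelSwap (E F : CircleBundle X) :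
    (borelSnd F E).comp (borelSwap E F) = borelFst E F := by
  ext x
  obtain ⟨y, rfl⟩ := borelMk_surjective x
  rfl

end CircleBundle

namespace Pair

open CircleBundle

theorem IsIsomorphic.symm {P Q : Pair X} (h : P.IsIsomorphic Q) : Q.IsIsomorphic P := by
  obtain ⟨φ, hφ⟩ := h
  refine ⟨φ.symm, ?_⟩
  change pullCoh 3 φ.borel Q.twist = P.twist at hφ
  change pullCoh 3 φ.symm.borel P.twist = Q.twist
  rw [← hφ, pullCoh_pullCoh, φ.borel_comp_borel_symm, pullCoh_id]

theorem isIsomorphic_of_iso (P : Pair X) {F : CircleBundle X} (φ : Iso P.bundle F) :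
    P.IsIsomorphic ⟨F, pullCoh 3 φ.symm.borel P.twist⟩ :=
  IsIsomorphic.symm ⟨φ.symm, rfl⟩

theorem IsTDual.symm {P Q : Pair X} (h : P.IsTDual Q) : Q.IsTDual P := by
  refine ⟨h.2.1, h.1, ?_⟩
  rw [← borelSnd_comp_borelSwap Q.bundle P.bundle, ← borelFst_comp_borelSwap Q.bundle P.bundle,
    ← pullCoh_pullCoh, ← pullCoh_pullCoh, h.2.2]

theorem IsTDual.of_isomorphic {P Q P' Q' : Pair X} (h : P'.IsTDual Q') (hP : P.IsIsomorphic P')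
    (hQ : Q.IsIsomorphic Q') : P.IsTDual Q := by
  obtain ⟨φ, hφ⟩ := hP
  obtain ⟨ψ, hψ⟩ := hQ
  change pullCoh 3 φ.borel P'.twist = P.twist at hφ
  change pullCoh 3 ψ.borel Q'.twist = Q.twist at hψ
  obtain ⟨⟨c, h1, h2⟩, ⟨c', h3, h4⟩, h5⟩ := h
  refine ⟨⟨c, h1.of_iso ψ, ?_⟩, ⟨c', h3.of_iso φ, ?_⟩, ?_⟩
  · rw [← hφ]
    exact h2.of_iso φ
  · rw [← hψ]
    exact h4.of_iso ψ
  · rw [← hφ, ← hψ, pullCoh_pullCoh, pullCoh_pullCoh, ← borelFst_comp_borelFibreProductMap φ ψ,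
      ← borelSnd_comp_borelFibreProductMap φ ψ, ← pullCoh_pullCoh, ← pullCoh_pullCoh, h5]

end Pair

end Transport

/-! ### Circle bundles over a point -/

section Classification

/-- A local trivialization at the point is a global coordinate. -/
theorem exists_coordinate (E : CircleBundle Unit) :
    ∃ e : E.Total ≃ₜ Circle, ∀ (u : Circle) (ξ : E.Total), e (u • ξ) = u * e ξ := by
  obtain ⟨t, ht, hu⟩ := E.locallyTrivial ()
  have hb : t.baseSet = Set.univ := Set.eq_univ_of_forall fun _ => ht
  have hs : t.toOpenPartialHomeomorph.source = Set.univ := by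
    rw [t.source_eq, hb, Set.preimage_univ]
  have htg : t.toOpenPartialHomeomorph.target = Set.univ := by
    rw [t.target_eq, hb, Set.univ_prod_univ]
  exact ⟨(t.toOpenPartialHomeomorph.toHomeomorphOfSourceEqUnivTargetEqUniv hs htg).trans
    (Homeomorph.punitProd Circle), fun u ξ => hu u ξ ht⟩

theorem iso_triv_or_free (E : CircleBundle Unit) :
    Nonempty (CircleBundle.Iso E circleTriv) ∨ Nonempty (CircleBundle.Iso E circleFree) := by
  obtain ⟨e, he⟩ := exists_coordinate E
  -- the involution is multiplication by `ε`, a square root of `1`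
  let ε := e ((-1 : ℤˣ) • e.symm 1)
  have hε : ∀ ξ : E.Total, e ((-1 : ℤˣ) • ξ) = e ξ * ε := by
    intro ξ
    have h1 : ξ = e ξ • e.symm 1 := e.injective (by rw [he, e.apply_symm_apply, mul_one])
    conv_lhs => rw [h1, smul_comm, he]
  have hsq : ε * ε = 1 := by
    have h1 := hε ((-1 : ℤˣ) • e.symm 1)
    rw [smul_smul, neg_mul_neg, mul_one, one_smul, e.apply_symm_apply] at h1
    exact h1.symm
  have hor : ε = 1 ∨ ε = -1 := by
    have h1 : (ε : ℂ) * ε = 1 := by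
      rw [← Circle.coe_mul, hsq, Circle.coe_one]
    rcases mul_self_eq_one_iff.1 h1 with h | h
    · exact Or.inl (Circle.ext h)
    · exact Or.inr (Circle.ext h)
  rcases hor with h | h
  · refine Or.inl ⟨⟨e.trans trivCoord.symm, fun _ => rfl, fun g ξ => ?_, fun u ξ => he u ξ⟩⟩
    rw [triv_smul]
    change e (g • ξ) = e ξ
    rcases Int.units_eq_one_or g with rfl | rfl
    · rw [one_smul]
    · rw [hε, h, mul_one]
  · refine Or.inr ⟨⟨e.trans freeCoord.symm, fun _ => rfl, fun g ξ => ?_, fun u ξ => he u ξ⟩⟩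
    rcases Int.units_eq_one_or g with rfl | rfl
    · rw [one_smul, one_smul]
    · change e ((-1 : ℤˣ) • ξ) = -e ξ
      rw [hε, h, mul_neg_one]

theorem isIsomorphic_triv_or_free (P : Pair Unit) :
    (∃ h, P.IsIsomorphic ⟨circleTriv, h⟩) ∨ P.IsIsomorphic ⟨circleFree, 0⟩ := by
  rcases iso_triv_or_free P.bundle with ⟨⟨φ⟩⟩ | ⟨⟨φ⟩⟩
  · exact Or.inl ⟨_, P.isIsomorphic_of_iso φ⟩
  · have := P.isIsomorphic_of_iso φ
    rw [eqCoh_free_eq_zero (pullCoh 3 φ.symm.borel P.twist)] at this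
    exact Or.inr this

theorem isTDual_triv_triv : Pair.IsTDual ⟨circleTriv, 0⟩ ⟨circleTriv, 0⟩ := by
  have h1 : circleTriv.IsChernClass (0 : EqCoh Unit 2) := (isChernClass_triv_iff _).2 rfl
  have h2 := isPushforward_zero (isAngular_triv isLogCochain_trivAngularCochain)
  exact ⟨⟨0, h1, h2⟩, ⟨0, h1, h2⟩, by rw [map_zero, map_zero]⟩

/-- On the fibre product, the pull-back of `π^* c ∪ α` is the coboundary of the product of the two
angular cochains, since the angular cochain of the free circle transgresses to `c`. -/
theorem pullCoh_borelSnd_tauClass :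
    pullCoh 3 (CircleBundle.borelSnd circleFree circleTriv) tauClass = 0 := by
  obtain ⟨α, hα⟩ := exists_isAngular_free
  rw [tauClass, pullCoh_cls]
  let p := CircleBundle.borelFst circleFree circleTriv
  let q := CircleBundle.borelSnd circleFree circleTriv
  have hpq : circleTriv.borelProj.comp q = circleFree.borelProj.comp p := by
    ext x
    obtain ⟨y, rfl⟩ := borelMk_surjective x
    rfl
  refine cls_eq_zero_iff.2 ⟨-(cup (pull 1 p α) (pull 1 q trivAngularCochain) : Cochain 2 _), ?_⟩
  have h1 : pull 2 q (pull 2 circleTriv.borelProj genCocycle) =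
      -cobd 1 (pull 1 p α) := by
    rw [cobd_pull, hα.cobd_eq, map_neg, neg_neg, pull_pull, pull_pull, hpq]
  rw [map_neg, cobd_cup_one_one, cobd_pull 1 q, cobd_trivAngularCochain, map_zero, cup_zero,
    sub_zero, ← neg_cup, ← h1]
  rfl

theorem isTDual_free_triv : Pair.IsTDual ⟨circleFree, 0⟩ ⟨circleTriv, tauClass⟩ := by
  obtain ⟨α, hα⟩ := exists_isAngular_free
  refine ⟨⟨0, (isChernClass_triv_iff _).2 rfl, isPushforward_zero hα⟩,
    ⟨cls genCocycle, (isChernClass_free_iff _).2 rfl, isPushforward_tauClass⟩, ?_⟩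
  rw [map_zero]
  exact pullCoh_borelSnd_tauClass.symm

theorem eq_tauClass_of_isTDual {h : EqCoh circleTriv.Total 3}
    (hd : Pair.IsTDual ⟨circleFree, 0⟩ ⟨circleTriv, h⟩) : h = tauClass := by
  obtain ⟨c, hc, hp⟩ := hd.2.1
  rw [(isChernClass_free_iff c).1 hc] at hp
  exact eq_tauClass_of_isPushforward hp

theorem eq_zero_of_isTDual {h k : EqCoh circleTriv.Total 3}
    (hd : Pair.IsTDual ⟨circleTriv, h⟩ ⟨circleTriv, k⟩) : h = 0 := by
  obtain ⟨c, hc, hp⟩ := hd.1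
  rw [(isChernClass_triv_iff c).1 hc] at hp
  exact eq_zero_of_isPushforward_zero hp

theorem not_isTDual_free_free : ¬ Pair.IsTDual ⟨circleFree, 0⟩ ⟨circleFree, 0⟩ := by
  rintro ⟨⟨c, hc, hp⟩, -⟩
  exact not_isPushforward_free hc hp

theorem isTDual_iff (P Q : Pair Unit) :
    P.IsTDual Q ↔
      (P.IsIsomorphic ⟨circleFree, 0⟩ ∧ Q.IsIsomorphic ⟨circleTriv, tauClass⟩) ∨
      (P.IsIsomorphic ⟨circleTriv, tauClass⟩ ∧ Q.IsIsomorphic ⟨circleFree, 0⟩) ∨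
      (P.IsIsomorphic ⟨circleTriv, 0⟩ ∧ Q.IsIsomorphic ⟨circleTriv, 0⟩) := by
  constructor
  · intro hd
    rcases isIsomorphic_triv_or_free P with ⟨h, hP⟩ | hP <;>
      rcases isIsomorphic_triv_or_free Q with ⟨k, hQ⟩ | hQ <;>
        have hd' := hd.of_isomorphic hP.symm hQ.symm
    · have h0 := eq_zero_of_isTDual hd'
      have k0 := eq_zero_of_isTDual hd'.symm
      subst h0 k0
      exact Or.inr (Or.inr ⟨hP, hQ⟩)
    · have h0 := eq_tauClass_of_isTDual hd'.symm
      subst h0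
      exact Or.inr (Or.inl ⟨hP, hQ⟩)
    · have k0 := eq_tauClass_of_isTDual hd'
      subst k0
      exact Or.inl ⟨hP, hQ⟩
    · exact absurd hd' not_isTDual_free_free
  · rintro (⟨hP, hQ⟩ | ⟨hP, hQ⟩ | ⟨hP, hQ⟩)
    · exact isTDual_free_triv.of_isomorphic hP hQ
    · exact isTDual_free_triv.symm.of_isomorphic hP hQ
    · exact isTDual_triv_triv.of_isomorphic hP hQ

end Classification

end EquivTDuality
end

open EquivTDuality in
theorem proposition5p1 :
    ∃ τ : EqCoh circleTriv.Total 3,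
      (∀ h : EqCoh circleTriv.Total 3, tauCocycle.Represents h ↔ h = τ) ∧
      ∀ P Q : Pair Unit,
        P.IsTDual Q ↔
          (P.IsIsomorphic ⟨circleFree, 0⟩ ∧ Q.IsIsomorphic ⟨circleTriv, τ⟩) ∨
          (P.IsIsomorphic ⟨circleTriv, τ⟩ ∧ Q.IsIsomorphic ⟨circleFree, 0⟩) ∨
          (P.IsIsomorphic ⟨circleTriv, 0⟩ ∧ Q.IsIsomorphic ⟨circleTriv, 0⟩) :=
  ⟨tauClass, tauCocycle_represents_iff, isTDual_iff⟩
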